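/- **Setting.** On $\mathbb{C}^2$ use coordinates $(x,y)$, where $y=\bar x$ on the real plane. Put $X_{lin}=i(x\partial_x-y\partial_y)$, let $r\ge 2$, and let $$X=X_{lin}+\sum_{j=r}^{2r-1}\bigl(P_j(x,y)\,\partial_x+\overline{P_j}\,\partial_y\bigr)$$ be real Hamiltonian. Here $P_j$ is a homogeneous polynomial of degree $j$, and $\overline{P_j}$ is obtained from $P_j$ by conjugating the coefficients and exchanging $x$ and $y$. Real Hamiltonian means that the $\partial_x$-component of $X$ is $2i\,\partial H/\partial y$ for some polynomial $H$ with $\overline{H}=H$. Denote by $p_{a,b}$ the coefficient of $x^{a+1}y^{b}$ in $P_{a+b+1}$, and put $$S=\sum_{k=\lfloor (r+1)/2\rfloor+1}^{r}\frac{r(r+1)}{(r-k+1)^2}\,|p_{k-1,r-k}|^2+\frac{r}{r+1}\,|p_{-1,r}|^2 .$$ **The mould series.** Write $X=X_{lin}+\sum_n B_n$, where for $n=(n^1,n^2)$ the operator $B_n=x^{n^1}y^{n^2}(p_n\,x\partial_x+q_n\,y\partial_y)$ collects the terms of $X$ of that degree; it maps monomials $x^ly^k$ to multiples of $x^{n^1+l}y^{n^2+k}$.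 The indices $n$ run over the letters $(k-1,j-k)$ with $j\ge2$ and $0\le k\le j+1$. Put $\omega(n)=i(n^1-n^2)$, and let the depth of a word be the sum of $n^1+n^2$ over its letters. Define numbers $Carr^{\mathbf n}$, for words $\mathbf n$ in these letters, as follows. - $Carr^{\emptyset}=0$. For a letter, $Carr^{n}=1$ if $\omega(n)=0$ and $Carr^{n}=0$ otherwise. - For words of length at least $2$, $Carr^{\mathbf n}=0$ if the first letter $n_1$ has $\omega(n_1)=0$. Otherwise $$\omega(n_1)\,Carr^{n_1n_2\cdots n_s}+Carr^{(n_1+n_2)n_3\cdots n_s}=\sum_{\mathbf b\mathbf c=n_2\cdots n_s}Carr^{n_1\mathbf c}\,Carr^{\mathbf b}.$$ Let $Carr_d(X)=\sum Carr^{n_1\cdots n_s}\,B_{n_1}\circ\cdots\circ B_{n_s}$, summed over the words of depth $d$. **The correction.** A correction of $X$ is a formal vector field $Z$ without terms of degree $\le 1$ such that $[X_{lin},Z]=0$ and $X-Z$ is formally conjugate to $X_{lin}$. The vector field $X$ is called linearisable if it is formally conjugate to $X_{lin}$. **Lemma (Fundamental Lemma).** 1. As differential operators on $\mathbb{C}[x,y]$,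 $$Carr_{2(r-1)}(X)=(xy)^{r-1}\bigl(c\,x\partial_x+\bar c\,y\partial_y\bigr),\qquad c=p_{r-1,r-1}+iS .$$ 2. For every correction $Z$ of $X$, the component of $Z$ of depth $2(r-1)$ (its homogeneous part of degree $2r-1$) is $$(xy)^{r-1}\bigl(c'\,x\partial_x+\bar c'\,y\partial_y\bigr),\qquad c'=p_{r-1,r-1}-iS .$$ 3. (Positivity obstruction.) If $X$ is linearisable, then $p_{r-1,r-1}=iS$. In particular $\operatorname{Im}p_{r-1,r-1}\ge 0$, and if $p_{r-1,r-1}=0$ then $P_r=0$. -/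

import Mathlib

/-! Planar vector fields `a ∂x + b ∂y` in the complex coordinates `x = X 0`, `y = X 1` (with
`y = x̄` on the real plane) are given by their two components, `![a, b]`. -/

noncomputable section

namespace Correction

open MvPolynomial

/-- Polynomial vector fields on `ℂ²`. -/
abbrev PolyField : Type := Fin 2 → MvPolynomial (Fin 2) ℂ

/-- Formal vector fields on `ℂ²` at the origin. -/
abbrev FormalField : Type := Fin 2 → MvPowerSeries (Fin 2) ℂ

/-- The polynomial vector field `F`, seen as a formal one. -/
def PolyField.toFormal (F : PolyField) : FormalField := fun i => (F i : MvPowerSeries (Fin 2) ℂ)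

/-- The coefficient of `x ^ k * y ^ l` in `f`. -/
def xyCoeff (f : MvPolynomial (Fin 2) ℂ) (k l : ℕ) : ℂ :=
  f.coeff (Finsupp.single 0 k + Finsupp.single 1 l)

/-- The complex conjugate of a polynomial in `x` and `y = x̄`: the coefficients are conjugated
and the two variables exchanged. -/
def conjPoly (f : MvPolynomial (Fin 2) ℂ) : MvPolynomial (Fin 2) ℂ :=
  rename (Equiv.swap 0 1) (map (starRingEnd ℂ) f)

/-- `X_lin = i (x ∂x - y ∂y)`. -/
def linField : PolyField := ![C Complex.I * X 0, -(C Complex.I * X 1)]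

/-- `i (x ∂x - y ∂y) + ∑_{j = r}^{2 r - 1} (P_j ∂x + conj P_j ∂y)`. -/
def perturbedField (r : ℕ) (P : ℕ → MvPolynomial (Fin 2) ℂ) : PolyField :=
  linField + ∑ j ∈ Finset.Icc r (2 * r - 1), ![P j, conjPoly (P j)]

/-- `F` is the complex form of a real Hamiltonian vector field. A real polynomial `H` on the
plane is a polynomial in `x, y` with `conjPoly H = H`; for `x = u + i v` the equations
`u' = -∂H/∂v`, `v' = ∂H/∂u` read `x' = 2 i ∂H/∂y`, and `y'` is the conjugate of `x'`. -/
def IsRealHamiltonian (F : PolyField) : Prop :=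
  F 1 = conjPoly (F 0) ∧
    ∃ H : MvPolynomial (Fin 2) ℂ, conjPoly H = H ∧ F 0 = C (2 * Complex.I) * pderiv 1 H

/-- `(x y) ^ m * (c * x ∂x + conj c * y ∂y)`. -/
def resonantField (m : ℕ) (c : ℂ) : PolyField :=
  ![C c * (X 0 * X 1) ^ m * X 0, C (starRingEnd ℂ c) * (X 0 * X 1) ^ m * X 1]

/-- A letter is a degree `(n¹, n²)`; entries may be `-1`. -/
abbrev Letter : Type := ℤ × ℤ

/-- The weight `ω(n) = ⟨n, λ⟩` for the eigenvalues `λ = (i, -i)` of `X_lin`. -/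
def weight (n : Letter) : ℂ := Complex.I * ((n.1 - n.2 : ℤ) : ℂ)

/-- The depth of a letter. -/
def letterDepth (n : Letter) : ℤ := n.1 + n.2

/-- The letters `(k - 1, j - k)`, `k = 0, …, j + 1`, produced by a component of degree `j`:
`(-1, j)`, `(k - 1, j - k)` for `1 ≤ k ≤ j`, and `(j, -1)`. -/
def lettersOfDegree (j : ℕ) : Finset Letter :=
  (Finset.range (j + 2)).image fun k : ℕ => ((k : ℤ) - 1, (j : ℤ) - k)

/-- The letters that can occur in a word of depth `d`: a letter of depth at most `d` comes
from a component of degree between `2` and `d + 1`. -/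
def alphabet (d : ℕ) : Finset Letter := (Finset.Icc 2 (d + 1)).biUnion lettersOfDegree

/-- The part of `f` on the monomial `x ^ a * y ^ b` (zero if an exponent is negative). -/
def monomialPart (f : MvPolynomial (Fin 2) ℂ) (a b : ℤ) : MvPolynomial (Fin 2) ℂ :=
  if 0 ≤ a ∧ 0 ≤ b then C (xyCoeff f a.toNat b.toNat) * X 0 ^ a.toNat * X 1 ^ b.toNat else 0

/-- The homogeneous differential operator `B_n` of degree `n` in the decomposition of `F`, that
is, `x ^ n¹ * y ^ n² * (p x ∂x + q y ∂y)` with the coefficients `p`, `q` taken from `F`. -/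
def homOperator (F : PolyField) (n : Letter) : Module.End ℂ (MvPolynomial (Fin 2) ℂ) :=
  (mkDerivation ℂ
    ![monomialPart (F 0) (n.1 + 1) n.2, monomialPart (F 1) n.1 (n.2 + 1)]).toLinearMap

/-- `B_w = B_{n_1} ∘ ⋯ ∘ B_{n_r}` for the word `w = n_1 ⋯ n_r`. -/
def wordOperator (F : PolyField) (w : List Letter) : Module.End ℂ (MvPolynomial (Fin 2) ℂ) :=
  (w.map (homOperator F)).prod

/-- The mould of the correction. It vanishes on the empty word, is `1` on resonant letters and
`0` on the other letters, vanishes on longer words beginning with a resonant letter, and is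
otherwise given by the variance formula
`ω(n₁) Carr^{n₁ n₂ w} + Carr^{(n₁ + n₂) w} = ∑_{b c = n₂ w} Carr^{n₁ c} Carr^b`
(the term with empty `b` is zero). -/
def carrMould : List Letter → ℂ
  | [] => 0
  | [n] => if weight n = 0 then 1 else 0
  | n :: m :: w =>
    if weight n = 0 then 0
    else
      ((∑ k : Fin (w.length + 1),
          carrMould (n :: w.drop k) * carrMould (m :: w.take k))
        - carrMould ((n + m) :: w)) / weight n
termination_by w => w.length
decreasing_by
  all_goals simp only [List.length_cons, List.length_drop, List.length_take]; omega

/-- The part of depth `d` of `∑_w Carr^w B_w`. All letters have depth at least `1`, so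
words of depth `d` have length at most `d`. -/
def carrDepth (F : PolyField) (d : ℕ) : Module.End ℂ (MvPolynomial (Fin 2) ℂ) :=
  ∑ l ∈ Finset.range (d + 1),
    ∑ w ∈ (Fintype.piFinset fun _ : Fin l => alphabet d) with
        ∑ i, letterDepth (w i) = (d : ℤ),
      carrMould (List.ofFn w) • wordOperator F (List.ofFn w)

/-- The Lie bracket `[A, B]` of formal vector fields. -/
def lieBracket (A B : FormalField) : FormalField := fun i =>
  ∑ j, (A j * MvPowerSeries.pderiv ℂ j (B i) - B j * MvPowerSeries.pderiv ℂ j (A i))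

/-- `A` and `B` are formally conjugate: some formal change of coordinates `Φ` fixing the origin
carries `A` to `B`, that is, `DΦ · A = B ∘ Φ`. -/
def FormallyConjugate (A B : FormalField) : Prop :=
  ∃ Φ : Fin 2 → MvPowerSeries (Fin 2) ℂ,
    (∀ i, MvPowerSeries.constantCoeff (Φ i) = 0) ∧
    IsUnit (Matrix.of fun i j => MvPowerSeries.coeff (Finsupp.single j 1) (Φ i)).det ∧
    ∀ i, ∑ j, A j * MvPowerSeries.pderiv ℂ j (Φ i) = (B i).subst Φ

/-- A vector field with linear part `X_lin` is linearisable if it is formally conjugate to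
`X_lin`. -/
def IsLinearisable (A : FormalField) : Prop := FormallyConjugate A linField.toFormal

/-- `Z` is the correction of `A`, a vector field with linear part `X_lin`: `Z` has no
terms of degree at most `1`, commutes with `X_lin`, and `A - Z` is formally conjugate to
`X_lin`. -/
def IsCorrection (A Z : FormalField) : Prop :=
  (∀ i, ∀ m : Fin 2 →₀ ℕ, m.degree ≤ 1 → MvPowerSeries.coeff m (Z i) = 0) ∧
    lieBracket linField.toFormal Z = 0 ∧ IsLinearisable (A - Z)

/-- `∑_{k = ⌊(r + 1) / 2⌋ + 1}^{r} r (r + 1) / (r - k + 1)² |p_{k-1, r-k}|²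
+ r / (r + 1) |p_{-1, r}|²`, where `p_{k-1, r-k}` is the coefficient of `x ^ k * y ^ (r - k)`
in `f`. -/
def birkhoffSum (r : ℕ) (f : MvPolynomial (Fin 2) ℂ) : ℝ :=
  ∑ k ∈ Finset.Icc ((r + 1) / 2 + 1) r,
      (r * (r + 1) : ℝ) / ((r : ℝ) - k + 1) ^ 2 * ‖xyCoeff f k (r - k)‖ ^ 2
    + (r : ℝ) / (r + 1) * ‖xyCoeff f 0 r‖ ^ 2

end Correction

end

noncomputable section

namespace Correction

open Finset

/-! Let h_kl be the coefficients of the Hamiltonian, so that conj h_kl = h_lk. The part of X of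
degree (k-1, l-1) is 2i h_kl times the Hamiltonian derivation of x^k y^l; for k + l ≥ 3 it vanishes
unless k + l ≥ r + 1. Hence a resonant term of degree 2r-1 receives, besides its linear
contribution, only products h_kl h_lk = |h_kl|² with k + l = r + 1. In these terms S = 2r(r+1) ∑
|h_kl|² over k + l = r + 1, k ≠ l (`birkhoffSum_eq`), and both computations end in this sum.

Correction: if Φ conjugates X - Z to X_lin, the components of Φ are eigenfunctions of X - Z
(`IsLinearisable.exists_eigenFamilies`). Their coefficients satisfy a recursion with divisors ι(p -
q - 1). At p = q + 1 the divisor is zero and the recursion becomes a constraint on the diagonal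
letters of X - Z: they vanish below (r, r) (`resonant_eq_zero`), and the one at (r, r) is a
quadratic sum in the off-diagonal letters (`resonant_eq`). Since Z commutes with X_lin, it changes
diagonal letters only, so the off-diagonal ones are those of X. Symmetrising under k ↔ l cancels the
divisors (`sum_quadratic`) and gives iS, which Z must leave behind (`letters_correction`).

Mould series: in depth 2(r-1) only words of length 1 and 2 survive. Those of length 2 have weights
∓1/ω and pair up into commutators, that is, Poisson brackets of x^k y^l and x^l y^k; they add up to
iS (`sum_commutators`). Composing the words in the opposite order would reverse the commutators,
which accounts for the opposite signs of S in the two results.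

Obstruction: a linearisable field has Z = 0 as a correction, so p = iS, and S is a sum of squares.
-/

/-- `f` is the family of coefficients of a formal eigenfunction, of linear part proportional
to `x`, of the vector field with linear part `ι (x ∂x - y ∂y)` whose homogeneous part of degree
`(k - 1, l - 1)` is `x ^ (k - 1) * y ^ (l - 1) * (α k l * x ∂x + β k l * y ∂y)`. -/
structure IsEigenFamily (ι : ℂ) (α β f : ℕ → ℕ → ℂ) : Prop where
  scale_ne : ι ≠ 0
  zero_right : ∀ k, α k 0 = 0
  constant : f 0 0 = 0
  linear_one : f 0 1 = 0
  linear_zero : f 1 0 ≠ 0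
  eigen : ∀ p q : ℕ, ι * ((p : ℂ) - q - 1) * f p q =
    -∑ x ∈ antidiagonal (p + 1), ∑ y ∈ antidiagonal (q + 1),
      (α x.1 y.1 * x.2 + β x.1 y.1 * y.2) * f x.2 y.2

/-! ### Recursion for the coefficients of a formal eigenfunction -/

namespace IsEigenFamily

variable {ι : ℂ} {α β f : ℕ → ℕ → ℂ}

lemma factor_ne (h : IsEigenFamily ι α β f) {p q : ℕ} (hpq : p ≠ q + 1) :
    ι * ((p : ℂ) - q - 1) ≠ 0 := by
  refine mul_ne_zero h.scale_ne fun h0 => hpq ?_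
  have : (p : ℂ) = ((q + 1 : ℕ) : ℂ) := by push_cast; linear_combination h0
  exact_mod_cast this

/-- In each product, letter size k + l and coefficient size a + b add up to p + q + 2. The
coefficient f_00 enters with factor 0, so every other letter has size at most N + 1 and vanishes,
while the divisor is nonzero. -/
lemma eq_zero_of_small (h : IsEigenFamily ι α β f) {N : ℕ}
    (hN : ∀ k l, k + l ≤ N + 1 → α k l = 0 ∧ β k l = 0) {p q : ℕ} (hs : p + q ≤ N)
    (hpq : p ≠ q + 1) : f p q = 0 := by
  have h1 := h.eigen p q
  rw [sum_eq_zero, neg_zero] at h1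
  · exact (mul_eq_zero.mp h1).resolve_left (h.factor_ne hpq)
  rintro ⟨k, a⟩ hx
  refine sum_eq_zero ?_
  rintro ⟨l, b⟩ hy
  rw [HasAntidiagonal.mem_antidiagonal] at hx hy
  dsimp only at hx hy ⊢
  by_cases hab : a = 0 ∧ b = 0
  · simp [hab.1, hab.2]
  · obtain ⟨h2, h3⟩ := hN k l (by omega)
    simp [h2, h3]

/-- First-order perturbation: the first nonzero letters can only meet a coefficient with a + b = 1,
and there f_01 = 0, so f_10 alone contributes. -/
lemma eq_of_first (h : IsEigenFamily ι α β f) {N : ℕ}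
    (hN : ∀ k l, k + l ≤ N → α k l = 0 ∧ β k l = 0) {p q : ℕ} (hs : p + q = N)
    (hpq : p ≠ q + 1) : f p q = -(α p (q + 1) * f 1 0) / (ι * ((p : ℂ) - q - 1)) := by
  rw [eq_div_iff (h.factor_ne hpq), mul_comm, h.eigen p q, neg_inj,
    sum_eq_single (p, 1), sum_eq_single (q + 1, 0)]
  · simp
  · rintro ⟨l, b⟩ hy hne
    rw [HasAntidiagonal.mem_antidiagonal] at hy
    have : b ≠ 0 := fun hb => hne (by ext <;> simp_all)
    obtain ⟨h2, h3⟩ := hN p l (by simp only at hy; omega)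
    simp [h2, h3]
  · simp
  · rintro ⟨k, a⟩ hx hne
    refine sum_eq_zero ?_
    rintro ⟨l, b⟩ hy
    rw [HasAntidiagonal.mem_antidiagonal] at hx hy
    dsimp only at hx hy ⊢
    have ha : a ≠ 1 := fun ha => hne (by ext <;> simp <;> omega)
    by_cases hab : a = 0
    · subst hab
      rcases Nat.lt_or_ge b 1 with hb | hb
      · obtain rfl : b = 0 := by omega
        simp
      rcases Nat.eq_or_lt_of_le hb with hb | hb
      · simp [← hb, h.linear_one]
      · obtain ⟨h2, h3⟩ := hN k l (by omega)
        simp [h2, h3]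
    · obtain ⟨h2, h3⟩ := hN k l (by omega)
      simp [h2, h3]
  · simp

/-- Resonant terms below the degree of the quadratic ones vanish. -/
lemma resonant_eq_zero (h : IsEigenFamily ι α β f) {r k : ℕ} (hr : 2 ≤ r) (hk : k < r)
    (hnr : ∀ c d, c ≠ d → c + d ≤ r → α c d = 0 ∧ β c d = 0)
    (hres : ∀ c < k, α c c = 0 ∧ β c c = 0) : α k k = 0 := by
  obtain _ | j := k
  · exact h.zero_right 0
  -- At a resonant exponent the left side is zero, so the right side is a constraint; its only
  -- surviving term is the diagonal letter times f_10.
  have h1 := h.eigen (j + 1) j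
  have h2 : ((j + 1 : ℕ) : ℂ) - j - 1 = 0 := by push_cast; ring
  rw [h2, mul_zero, zero_mul, eq_comm, neg_eq_zero, sum_eq_single (j + 1, 1),
    sum_eq_single (j + 1, 0)] at h1
  · simpa [h.linear_zero] using h1
  · rintro ⟨l, b⟩ hy hne
    rw [HasAntidiagonal.mem_antidiagonal] at hy
    dsimp only at hy ⊢
    have hb : b ≠ 0 := fun hb => hne (by ext <;> simp <;> omega)
    by_cases hs : j + 1 + l ≤ r
    · obtain ⟨h3, h4⟩ := hnr (j + 1) l (by omega) hs
      simp [h3, h4]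
    · have : f 1 b = 0 := by
        -- A letter of size above r leaves a coefficient of size at most N = 2(j+1) - r. As j + 1 <
        -- r, N + 1 ≤ j + 1, so the diagonal letters of size at most N + 1 have index below j + 1
        -- and are known to vanish.
        refine h.eq_zero_of_small (N := 2 * (j + 1) - r) (fun c d hcd => ?_) (by omega) (by omega)
        by_cases hc : c = d
        · subst hc; exact hres c (by omega)
        · exact hnr c d hc (by omega)
      simp [this]
  · simp
  · rintro ⟨c, a⟩ hx hne
    refine sum_eq_zero ?_
    rintro ⟨d, b⟩ hy
    rw [HasAntidiagonal.mem_antidiagonal] at hx hy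
    dsimp only at hx hy ⊢
    have ha : a ≠ 1 := fun ha => hne (by ext <;> simp <;> omega)
    by_cases hcd : c = d
    · subst hcd
      obtain ⟨h3, h4⟩ := hres c (by omega)
      simp [h3, h4]
    by_cases hs : c + d ≤ r
    · obtain ⟨h3, h4⟩ := hnr c d hcd hs
      simp [h3, h4]
    · have : f a b = 0 := by
        refine h.eq_zero_of_small (N := 2 * (j + 1) - r) (fun c d hcd => ?_) (by omega) (by omega)
        by_cases hc : c = d
        · subst hc; exact hres c (by omega)
        · exact hnr c d hc (by omega)
      simp [this]
  · simp

/-- The resonant term of the degree where the quadratic terms first appear. -/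
lemma resonant_eq (h : IsEigenFamily ι α β f) {r : ℕ} (hr : 2 ≤ r)
    (hnr : ∀ c d, c ≠ d → c + d ≤ r → α c d = 0 ∧ β c d = 0)
    (hres : ∀ c < r, α c c = 0 ∧ β c c = 0) :
    α r r = ∑ x ∈ antidiagonal (r + 1),
      (α x.1 x.2 * x.2 + β x.1 x.2 * ((x.1 : ℂ) - 1)) * α x.2 x.1 /
        (ι * ((x.2 : ℂ) - x.1)) := by
  have hlow : ∀ c d, c + d ≤ r → α c d = 0 ∧ β c d = 0 := by
    intro c d hcd
    by_cases hc : c = d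
    · subst hc; exact hres c (by omega)
    · exact hnr c d hc hcd
  have h1 := h.eigen r (r - 1)
  obtain ⟨j, rfl⟩ : ∃ j, r = j + 1 := ⟨r - 1, by omega⟩
  simp only [Nat.add_sub_cancel] at h1
  have h2 : ((j + 1 : ℕ) : ℂ) - j - 1 = 0 := by push_cast; ring
  rw [h2, mul_zero, zero_mul, eq_comm, neg_eq_zero] at h1
  -- Two kinds of products survive: the diagonal letter (r, r) with f_10, and a letter of size r + 1
  -- with a coefficient of size r. The latter forces d = a and b = c - 1, and `eq_of_first`
  -- evaluates the coefficient.
  have key : ∀ x ∈ antidiagonal (j + 1 + 1), ∀ y ∈ antidiagonal (j + 1),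
      (α x.1 y.1 * x.2 + β x.1 y.1 * y.2) * f x.2 y.2 =
        (if y = (j + 1, 0) then if x = (j + 1, 1) then α (j + 1) (j + 1) * f 1 0 else 0 else 0) +
        if y.1 = x.2 then -f 1 0 * ((α x.1 x.2 * x.2 + β x.1 x.2 * ((x.1 : ℂ) - 1)) * α x.2 x.1 /
        (ι * ((x.2 : ℂ) - x.1))) else 0 := by
    rintro ⟨c, a⟩ hx ⟨d, b⟩ hy
    rw [HasAntidiagonal.mem_antidiagonal] at hx hy
    simp only [Prod.mk.injEq] at hx hy ⊢
    by_cases hda : d = a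
    · subst hda
      rw [if_pos rfl]
      by_cases hcd : c = d
      · subst hcd
        obtain ⟨h3, h4⟩ := hres c (by omega)
        rw [if_neg (by omega)]
        simp [h3, h4]
      · have h3 : (if d = j + 1 ∧ b = 0 then
            if c = j + 1 ∧ d = 1 then α (j + 1) (j + 1) * f 1 0 else 0 else 0) = 0 := by
          split_ifs <;> first | rfl | omega
        obtain rfl : c = b + 1 := by omega
        rw [h3, h.eq_of_first (N := j + 1) hlow (by omega) (by omega)]
        push_cast
        rw [show (d : ℂ) - b - 1 = d - (b + 1) by ring]
        ring
    · rw [if_neg hda, add_zero]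
      by_cases hcd : c = d
      · subst hcd
        by_cases hc : c = j + 1
        · obtain rfl : b = 0 := by omega
          obtain rfl : a = 1 := by omega
          simp [hc]
        · obtain ⟨h3, h4⟩ := hres c (by omega)
          simp [h3, h4, hc]
      · have h3 : (if d = j + 1 ∧ b = 0 then
            if c = j + 1 ∧ a = 1 then α (j + 1) (j + 1) * f 1 0 else 0 else 0) = 0 := by
          split_ifs <;> first | rfl | omega
        rw [h3]
        by_cases hs : c + d ≤ j + 1
        · obtain ⟨h3, h4⟩ := hnr c d hcd hs
          simp [h3, h4]
        · rw [h.eq_zero_of_small (N := j) hlow (by omega) (by omega), mul_zero]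
  rw [sum_congr rfl fun x hx => sum_congr rfl fun y hy => key x hx y hy] at h1
  simp only [sum_add_distrib] at h1
  rw [sum_comm] at h1
  have e1 : ∑ y ∈ antidiagonal (j + 1), ∑ x ∈ antidiagonal (j + 1 + 1),
      (if y = (j + 1, 0) then if x = (j + 1, 1) then α (j + 1) (j + 1) * f 1 0 else 0 else 0) =
      α (j + 1) (j + 1) * f 1 0 := by
    rw [sum_eq_single (j + 1, 0) (fun y _ hy => by simp [hy]) (by simp),
      sum_eq_single (j + 1, 1) (fun x _ hx => by simp [hx]) (by simp)]
    simp
  rw [e1] at h1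
  have e2 : ∀ x ∈ antidiagonal (j + 1 + 1), ∑ y ∈ antidiagonal (j + 1),
      (if y.1 = x.2 then -f 1 0 * ((α x.1 x.2 * x.2 + β x.1 x.2 * ((x.1 : ℂ) - 1)) * α x.2 x.1 /
        (ι * ((x.2 : ℂ) - x.1))) else 0) =
      -f 1 0 * ((α x.1 x.2 * x.2 + β x.1 x.2 * ((x.1 : ℂ) - 1)) * α x.2 x.1 /
        (ι * ((x.2 : ℂ) - x.1))) := by
    rintro ⟨c, d⟩ hx
    rw [HasAntidiagonal.mem_antidiagonal] at hx
    dsimp only at hx ⊢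
    -- For c = 0 there is no matching b = c - 1, but the claimed term is also zero because α d 0 =
    -- 0.
    obtain _ | b := c
    · simp [h.zero_right]
    · rw [sum_eq_single (d, b)]
      · exact if_pos rfl
      · rintro ⟨d', b'⟩ hy hne
        rw [HasAntidiagonal.mem_antidiagonal] at hy
        dsimp only at hy ⊢
        exact if_neg fun hd => hne (Prod.ext hd (by dsimp only; omega))
      · intro hn
        exact absurd (HasAntidiagonal.mem_antidiagonal.2 (by simp only; omega)) hn
  rw [sum_congr rfl e2, ← mul_sum] at h1
  refine mul_right_cancel₀ h.linear_zero ?_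
  linear_combination h1

end IsEigenFamily

/-! ### Coefficients of formal series and letters of formal vector fields -/

/-- The exponent of `x ^ k * y ^ l`. -/
abbrev xyExp (k l : ℕ) : Fin 2 →₀ ℕ := Finsupp.single 0 k + Finsupp.single 1 l

lemma eq_xyExp (m : Fin 2 →₀ ℕ) : m = xyExp (m 0) (m 1) := by
  ext i; fin_cases i <;> simp

lemma xyExp_injective {k l k' l' : ℕ} : xyExp k l = xyExp k' l' ↔ k = k' ∧ l = l' := by
  refine ⟨fun h => ⟨?_, ?_⟩, fun h => by rw [h.1, h.2]⟩
  · simpa using DFunLike.congr_fun h 0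
  · simpa using DFunLike.congr_fun h 1

lemma degree_xyExp (k l : ℕ) : (xyExp k l).degree = k + l := by
  simp [Finsupp.degree_eq_sum]

/-- The coefficient of `x ^ k * y ^ l` in a power series. -/
def serCoeff (f : MvPowerSeries (Fin 2) ℂ) (k l : ℕ) : ℂ := MvPowerSeries.coeff (xyExp k l) f

lemma serCoeff_coe (f : MvPolynomial (Fin 2) ℂ) (k l : ℕ) :
    serCoeff (f : MvPowerSeries (Fin 2) ℂ) k l = xyCoeff f k l := by
  simp [serCoeff, xyCoeff, MvPolynomial.coeff_coe]

lemma serCoeff_add (f g : MvPowerSeries (Fin 2) ℂ) (k l : ℕ) :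
    serCoeff (f + g) k l = serCoeff f k l + serCoeff g k l := map_add _ f g

lemma serCoeff_sub (f g : MvPowerSeries (Fin 2) ℂ) (k l : ℕ) :
    serCoeff (f - g) k l = serCoeff f k l - serCoeff g k l := map_sub _ f g

lemma serCoeff_C_mul (c : ℂ) (f : MvPowerSeries (Fin 2) ℂ) (k l : ℕ) :
    serCoeff (MvPowerSeries.C c * f) k l = c * serCoeff f k l :=
  MvPowerSeries.coeff_C_mul _ _ _

lemma serCoeff_mul (f g : MvPowerSeries (Fin 2) ℂ) (p q : ℕ) :
    serCoeff (f * g) p q = ∑ x ∈ antidiagonal p, ∑ y ∈ antidiagonal q,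
      serCoeff f x.1 y.1 * serCoeff g x.2 y.2 := by
  classical
  rw [serCoeff, MvPowerSeries.coeff_mul, ← sum_product']
  refine sum_nbij' (fun u => ((u.1 0, u.2 0), (u.1 1, u.2 1)))
    (fun z => (xyExp z.1.1 z.2.1, xyExp z.1.2 z.2.2)) ?_ ?_ ?_ ?_ ?_
  · rintro ⟨u, v⟩ h
    rw [HasAntidiagonal.mem_antidiagonal] at h
    simp only [mem_product, HasAntidiagonal.mem_antidiagonal]
    exact ⟨by simpa using DFunLike.congr_fun h 0, by simpa using DFunLike.congr_fun h 1⟩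
  · rintro ⟨⟨a, b⟩, ⟨c, d⟩⟩ h
    simp only [mem_product, HasAntidiagonal.mem_antidiagonal] at h ⊢
    rw [← h.1, ← h.2]
    simp only [xyExp, Finsupp.single_add]
    abel
  · rintro ⟨u, v⟩ -
    exact Prod.ext (eq_xyExp u).symm (eq_xyExp v).symm
  · rintro ⟨⟨a, b⟩, ⟨c, d⟩⟩ -
    simp
  · rintro ⟨u, v⟩ -
    simp only [serCoeff]
    rw [← eq_xyExp u, ← eq_xyExp v]

lemma serCoeff_X_zero_mul_succ (f : MvPowerSeries (Fin 2) ℂ) (k l : ℕ) :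
    serCoeff (MvPowerSeries.X 0 * f) (k + 1) l = serCoeff f k l := by
  rw [serCoeff, show xyExp (k + 1) l = Finsupp.single 0 1 + xyExp k l by
    simp only [xyExp, Finsupp.single_add]; abel, MvPowerSeries.X_def,
    MvPowerSeries.coeff_add_monomial_mul, one_mul, serCoeff]

lemma serCoeff_X_one_mul_succ (f : MvPowerSeries (Fin 2) ℂ) (k l : ℕ) :
    serCoeff (MvPowerSeries.X 1 * f) k (l + 1) = serCoeff f k l := by
  rw [serCoeff, show xyExp k (l + 1) = Finsupp.single 1 1 + xyExp k l by
    simp only [xyExp, Finsupp.single_add]; abel, MvPowerSeries.X_def,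
    MvPowerSeries.coeff_add_monomial_mul, one_mul, serCoeff]

lemma serCoeff_X_zero_mul_zero (f : MvPowerSeries (Fin 2) ℂ) (l : ℕ) :
    serCoeff (MvPowerSeries.X 0 * f) 0 l = 0 := by
  classical
  rw [serCoeff, MvPowerSeries.X_def, MvPowerSeries.coeff_monomial_mul, if_neg]
  intro h
  simpa using h 0

lemma serCoeff_X_one_mul_zero (f : MvPowerSeries (Fin 2) ℂ) (k : ℕ) :
    serCoeff (MvPowerSeries.X 1 * f) k 0 = 0 := by
  classical
  rw [serCoeff, MvPowerSeries.X_def, MvPowerSeries.coeff_monomial_mul, if_neg]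
  intro h
  simpa using h 1

lemma serCoeff_euler_zero (f : MvPowerSeries (Fin 2) ℂ) (k l : ℕ) :
    serCoeff (MvPowerSeries.X 0 * MvPowerSeries.pderiv ℂ 0 f) k l = k * serCoeff f k l := by
  obtain _ | k := k
  · simp [serCoeff_X_zero_mul_zero]
  · rw [serCoeff_X_zero_mul_succ, serCoeff, MvPowerSeries.coeff_pderiv, serCoeff,
      show xyExp (k + 1) l = xyExp k l + Finsupp.single 0 1 by
        simp only [xyExp, Finsupp.single_add]; abel]
    simp [mul_comm]

lemma serCoeff_euler_one (f : MvPowerSeries (Fin 2) ℂ) (k l : ℕ) :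
    serCoeff (MvPowerSeries.X 1 * MvPowerSeries.pderiv ℂ 1 f) k l = l * serCoeff f k l := by
  obtain _ | l := l
  · simp [serCoeff_X_one_mul_zero]
  · rw [serCoeff_X_one_mul_succ, serCoeff, MvPowerSeries.coeff_pderiv, serCoeff,
      show xyExp k (l + 1) = xyExp k l + Finsupp.single 1 1 by
        simp only [xyExp, Finsupp.single_add]; abel]
    simp [mul_comm]

/-- The coefficient of `x ^ (k - 1) * y ^ (l - 1) * x ∂x` in a vector field. -/
def xLetter (W : FormalField) (k l : ℕ) : ℂ := serCoeff (MvPowerSeries.X 1 * W 0) k l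

/-- The coefficient of `x ^ (k - 1) * y ^ (l - 1) * y ∂y` in a vector field. -/
def yLetter (W : FormalField) (k l : ℕ) : ℂ := serCoeff (MvPowerSeries.X 0 * W 1) k l

lemma xLetter_zero_right (W : FormalField) (k : ℕ) : xLetter W k 0 = 0 :=
  serCoeff_X_one_mul_zero _ _

lemma yLetter_zero_left (W : FormalField) (l : ℕ) : yLetter W 0 l = 0 :=
  serCoeff_X_zero_mul_zero _ _

lemma xLetter_succ (W : FormalField) (k l : ℕ) : xLetter W k (l + 1) = serCoeff (W 0) k l :=
  serCoeff_X_one_mul_succ _ _ _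

lemma yLetter_succ (W : FormalField) (k l : ℕ) : yLetter W (k + 1) l = serCoeff (W 1) k l :=
  serCoeff_X_zero_mul_succ _ _ _

lemma linField_toFormal_zero :
    linField.toFormal 0 = MvPowerSeries.C Complex.I * MvPowerSeries.X 0 := by
  simp [PolyField.toFormal, linField]

lemma linField_toFormal_one :
    linField.toFormal 1 = -(MvPowerSeries.C Complex.I * MvPowerSeries.X 1) := by
  change ((-(MvPolynomial.C Complex.I * MvPolynomial.X 1) : MvPolynomial (Fin 2) ℂ) :
    MvPowerSeries (Fin 2) ℂ) = _
  rw [← neg_mul, ← map_neg, ← neg_mul, ← map_neg, MvPolynomial.coe_mul, MvPolynomial.coe_C,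
    MvPolynomial.coe_X]

/-- The action of `X_lin` on coefficients. -/
lemma serCoeff_linField (f : MvPowerSeries (Fin 2) ℂ) (p q : ℕ) :
    serCoeff (∑ j, linField.toFormal j * MvPowerSeries.pderiv ℂ j f) p q =
      Complex.I * ((p : ℂ) - q) * serCoeff f p q := by
  rw [Fin.sum_univ_two, linField_toFormal_zero, linField_toFormal_one,
    show MvPowerSeries.C Complex.I * MvPowerSeries.X 0 * MvPowerSeries.pderiv ℂ 0 f +
      -(MvPowerSeries.C Complex.I * MvPowerSeries.X 1) * MvPowerSeries.pderiv ℂ 1 f =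
      MvPowerSeries.C Complex.I * (MvPowerSeries.X 0 * MvPowerSeries.pderiv ℂ 0 f -
        MvPowerSeries.X 1 * MvPowerSeries.pderiv ℂ 1 f) by ring,
    serCoeff_C_mul, serCoeff_sub, serCoeff_euler_zero, serCoeff_euler_one]
  ring

/-- The action of a vector field on coefficients. -/
lemma serCoeff_field (W : FormalField) (f : MvPowerSeries (Fin 2) ℂ) (p q : ℕ) :
    serCoeff (∑ j, W j * MvPowerSeries.pderiv ℂ j f) p q =
      ∑ x ∈ antidiagonal (p + 1), ∑ y ∈ antidiagonal (q + 1),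
        (xLetter W x.1 y.1 * x.2 + yLetter W x.1 y.1 * y.2) * serCoeff f x.2 y.2 := by
  -- Multiplying by xy makes all exponents of the letters nonnegative and turns the derivatives into
  -- the Euler operators x∂x and y∂y; hence the antidiagonals of p + 1 and q + 1.
  rw [← serCoeff_X_one_mul_succ, ← serCoeff_X_zero_mul_succ, Fin.sum_univ_two,
    show MvPowerSeries.X 0 * (MvPowerSeries.X 1 * (W 0 * MvPowerSeries.pderiv ℂ 0 f +
      W 1 * MvPowerSeries.pderiv ℂ 1 f)) =
      (MvPowerSeries.X 1 * W 0) * (MvPowerSeries.X 0 * MvPowerSeries.pderiv ℂ 0 f) +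
      (MvPowerSeries.X 0 * W 1) * (MvPowerSeries.X 1 * MvPowerSeries.pderiv ℂ 1 f) by ring,
    serCoeff_add, serCoeff_mul, serCoeff_mul, ← sum_add_distrib]
  refine sum_congr rfl fun x _ => ?_
  rw [← sum_add_distrib]
  refine sum_congr rfl fun y _ => ?_
  rw [serCoeff_euler_zero, serCoeff_euler_one, xLetter, yLetter]
  ring

/-! ### Resonant support and eigenfunctions of linearisable fields -/

/-- A field commuting with `X_lin` is supported on resonant monomials. -/
lemma serCoeff_eq_zero_of_bracket {Z : FormalField} (hZ : lieBracket linField.toFormal Z = 0)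
    (p q : ℕ) : (p ≠ q + 1 → serCoeff (Z 0) p q = 0) ∧ (q ≠ p + 1 → serCoeff (Z 1) p q = 0) := by
  have key : ∀ i, serCoeff (∑ j, linField.toFormal j * MvPowerSeries.pderiv ℂ j (Z i)) p q =
      serCoeff (∑ j, Z j * MvPowerSeries.pderiv ℂ j (linField.toFormal i)) p q := by
    intro i
    have := congrFun hZ i
    rw [lieBracket, sum_sub_distrib, Pi.zero_apply, sub_eq_zero] at this
    rw [this]
  have e0 : ∑ j, Z j * MvPowerSeries.pderiv ℂ j (linField.toFormal 0) =
      MvPowerSeries.C Complex.I * Z 0 := by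
    rw [Fin.sum_univ_two, linField_toFormal_zero]
    simp [Derivation.leibniz, MvPowerSeries.pderiv_X_of_ne, mul_comm]
  have e1 : ∑ j, Z j * MvPowerSeries.pderiv ℂ j (linField.toFormal 1) =
      MvPowerSeries.C (-Complex.I) * Z 1 := by
    rw [Fin.sum_univ_two, linField_toFormal_one]
    simp [Derivation.leibniz, MvPowerSeries.pderiv_X_of_ne, mul_comm]
  constructor
  · intro hpq
    have h := key 0
    rw [e0, serCoeff_linField, serCoeff_C_mul] at h
    have h' : ((p : ℂ) - q - 1) * serCoeff (Z 0) p q = 0 :=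
      mul_left_cancel₀ Complex.I_ne_zero (by linear_combination h)
    refine (mul_eq_zero.mp h').resolve_left fun h0 => hpq ?_
    have : (p : ℂ) = ((q + 1 : ℕ) : ℂ) := by push_cast; linear_combination h0
    exact_mod_cast this
  · intro hpq
    have h := key 1
    rw [e1, serCoeff_linField, serCoeff_C_mul] at h
    have h' : ((q : ℂ) - p - 1) * serCoeff (Z 1) p q = 0 :=
      mul_left_cancel₀ Complex.I_ne_zero (by linear_combination -h)
    refine (mul_eq_zero.mp h').resolve_left fun h0 => hpq ?_
    have : (q : ℂ) = ((p + 1 : ℕ) : ℂ) := by push_cast; linear_combination h0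
    exact_mod_cast this

lemma letters_of_order {Y : FormalField}
    (hY : ∀ i, ∀ m : Fin 2 →₀ ℕ, m.degree ≤ 1 → MvPowerSeries.coeff m (Y i) = 0) {k l : ℕ}
    (hkl : k + l ≤ 2) : xLetter Y k l = 0 ∧ yLetter Y k l = 0 := by
  constructor
  · obtain _ | l := l
    · exact xLetter_zero_right _ _
    · rw [xLetter_succ]
      exact hY 0 _ (by rw [degree_xyExp]; omega)
  · obtain _ | k := k
    · exact yLetter_zero_left _ _
    · rw [yLetter_succ]
      exact hY 1 _ (by rw [degree_xyExp]; omega)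

/-- A field with linear part `X_lin` that is linearisable has eigenfunctions with the eigenvalues
`i` and `-i` and linear parts proportional to `x` and `y`. -/
lemma IsLinearisable.exists_eigenFamilies {Y : FormalField}
    (hY : ∀ i, ∀ m : Fin 2 →₀ ℕ, m.degree ≤ 1 → MvPowerSeries.coeff m (Y i) = 0)
    (h : IsLinearisable (linField.toFormal + Y)) :
    (∃ f, IsEigenFamily Complex.I (xLetter Y) (yLetter Y) f) ∧
      ∃ f, IsEigenFamily (-Complex.I) (fun k l => yLetter Y l k) (fun k l => xLetter Y l k) f := by
  obtain ⟨Φ, hΦ, hdet, hconj⟩ := h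
  have hs : MvPowerSeries.HasSubst Φ := MvPowerSeries.hasSubst_of_constantCoeff_zero hΦ
  have s0 : (linField.toFormal 0).subst Φ = MvPowerSeries.C Complex.I * Φ 0 := by
    rw [linField_toFormal_zero, MvPowerSeries.subst_mul hs, MvPowerSeries.subst_X hs]
    congr 1
    exact MvPowerSeries.subst_C _
  have s1 : (linField.toFormal 1).subst Φ = MvPowerSeries.C (-Complex.I) * Φ 1 := by
    rw [linField_toFormal_one, ← neg_mul, ← map_neg, MvPowerSeries.subst_mul hs,
      MvPowerSeries.subst_X hs]
    congr 1
    exact MvPowerSeries.subst_C _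
  -- Since X_lin is diagonal, the conjugacy equation says that each Φ_i is an eigenfunction of X_lin
  -- + Y.
  have eqn : ∀ (i : Fin 2) (c : ℂ), (linField.toFormal i).subst Φ = MvPowerSeries.C c * Φ i →
      ∀ p q : ℕ, (Complex.I * ((p : ℂ) - q) - c) * serCoeff (Φ i) p q =
        -∑ x ∈ antidiagonal (p + 1), ∑ y ∈ antidiagonal (q + 1),
          (xLetter Y x.1 y.1 * x.2 + yLetter Y x.1 y.1 * y.2) * serCoeff (Φ i) x.2 y.2 := by
    intro i c hc p q
    have h1 := congrArg (fun g => serCoeff g p q) (hconj i)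
    simp only [Pi.add_apply, add_mul, sum_add_distrib] at h1
    rw [hc, serCoeff_add, serCoeff_linField, serCoeff_field, serCoeff_C_mul] at h1
    linear_combination h1
  have c0 : ∀ i, serCoeff (Φ i) 0 0 = 0 := fun i => by
    simpa [serCoeff, xyExp] using hΦ i
  have lin : ∀ (i : Fin 2) (p q : ℕ), p + q = 1 →
      ∑ x ∈ antidiagonal (p + 1), ∑ y ∈ antidiagonal (q + 1),
          (xLetter Y x.1 y.1 * x.2 + yLetter Y x.1 y.1 * y.2) * serCoeff (Φ i) x.2 y.2 = 0 := by
    intro i p q hpq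
    refine sum_eq_zero ?_
    rintro ⟨k, a⟩ hx
    refine sum_eq_zero ?_
    rintro ⟨l, b⟩ hy
    rw [HasAntidiagonal.mem_antidiagonal] at hx hy
    dsimp only at hx hy ⊢
    by_cases hab : a = 0 ∧ b = 0
    · simp [hab.1, hab.2]
    · obtain ⟨h2, h3⟩ := letters_of_order hY (k := k) (l := l) (by omega)
      simp [h2, h3]
  -- Y has no linear part, so the linear part of Φ_i is an eigenvector of X_lin; the eigenvalues i
  -- and -i differ, which removes the mixed coefficients and makes the Jacobian diagonal.
  have z01 : serCoeff (Φ 0) 0 1 = 0 := by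
    have := eqn 0 _ s0 0 1
    rw [lin 0 0 1 rfl, neg_zero] at this
    refine (mul_eq_zero.mp this).resolve_left fun h0 => Complex.I_ne_zero ?_
    push_cast at h0
    linear_combination (-1 / 2 : ℂ) * h0
  have z10 : serCoeff (Φ 1) 1 0 = 0 := by
    have := eqn 1 _ s1 1 0
    rw [lin 1 1 0 rfl, neg_zero] at this
    refine (mul_eq_zero.mp this).resolve_left fun h0 => Complex.I_ne_zero ?_
    push_cast at h0
    linear_combination (1 / 2 : ℂ) * h0
  have ne : serCoeff (Φ 0) 1 0 ≠ 0 ∧ serCoeff (Φ 1) 0 1 ≠ 0 := by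
    rw [Matrix.det_fin_two] at hdet
    have e10 : ∀ i, serCoeff (Φ i) 1 0 = MvPowerSeries.coeff (Finsupp.single 0 1) (Φ i) := by
      intro i; simp [serCoeff, xyExp]
    have e01 : ∀ i, serCoeff (Φ i) 0 1 = MvPowerSeries.coeff (Finsupp.single 1 1) (Φ i) := by
      intro i; simp [serCoeff, xyExp]
    simp only [Matrix.of_apply, ← e10, ← e01, z01, zero_mul, sub_zero] at hdet
    exact ⟨left_ne_zero_of_mul hdet.ne_zero, right_ne_zero_of_mul hdet.ne_zero⟩
  refine ⟨⟨serCoeff (Φ 0), Complex.I_ne_zero, xLetter_zero_right Y, c0 0, z01, ne.1, ?_⟩,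
    ⟨fun k l => serCoeff (Φ 1) l k, neg_ne_zero.2 Complex.I_ne_zero,
      yLetter_zero_left Y, c0 1, z10, ne.2, ?_⟩⟩
  · intro p q
    rw [← eqn 0 _ s0]
    ring
  · intro p q
    have h1 := eqn 1 _ s1 q p
    rw [sum_comm] at h1
    rw [show -Complex.I * ((p : ℂ) - q - 1) = Complex.I * ((q : ℂ) - p) - -Complex.I by ring, h1]
    refine congrArg Neg.neg (sum_congr rfl fun x _ => sum_congr rfl fun y _ => ?_)
    rw [add_comm (xLetter Y y.1 x.1 * _)]

/-! ### Coefficients of a real Hamiltonian -/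

lemma xyCoeff_add (f g : MvPolynomial (Fin 2) ℂ) (k l : ℕ) :
    xyCoeff (f + g) k l = xyCoeff f k l + xyCoeff g k l := MvPolynomial.coeff_add _ _ _

lemma xyCoeff_conjPoly (f : MvPolynomial (Fin 2) ℂ) (k l : ℕ) :
    xyCoeff (conjPoly f) k l = starRingEnd ℂ (xyCoeff f l k) := by
  have e : xyExp k l = (xyExp l k).mapDomain (Equiv.swap 0 1) := by
    simp [xyExp, Finsupp.mapDomain_add, Finsupp.mapDomain_single, add_comm]
  rw [xyCoeff, conjPoly]
  change MvPolynomial.coeff (xyExp k l) _ = _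
  rw [e, MvPolynomial.coeff_rename_mapDomain _ (Equiv.injective _), MvPolynomial.coeff_map]
  rfl

lemma xyCoeff_pderiv_one (f : MvPolynomial (Fin 2) ℂ) (k l : ℕ) :
    xyCoeff (MvPolynomial.pderiv 1 f) k l = (l + 1) * xyCoeff f k (l + 1) := by
  rw [xyCoeff, MvPolynomial.coeff_pderiv, xyCoeff, Finsupp.single_add (a := (1 : Fin 2)), ← add_assoc]
  simp [mul_comm]

/-- `h k l` are the coefficients of a real Hamiltonian of the field `F`. -/
structure HasHamiltonianCoeffs (F : PolyField) (h : ℕ → ℕ → ℂ) : Prop where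
  conj_eq : ∀ k l, starRingEnd ℂ (h k l) = h l k
  zero_eq : ∀ k l, xyCoeff (F 0) k l = 2 * Complex.I * ((l + 1) * h k (l + 1))
  one_eq : ∀ k l, xyCoeff (F 1) k l = -(2 * Complex.I * ((k + 1) * h (k + 1) l))

lemma IsRealHamiltonian.exists_coeffs {F : PolyField} (hF : IsRealHamiltonian F) :
    ∃ h, HasHamiltonianCoeffs F h := by
  obtain ⟨h1, H, hH, h0⟩ := hF
  have hc : ∀ k l, starRingEnd ℂ (xyCoeff H k l) = xyCoeff H l k := fun k l => by
    rw [← xyCoeff_conjPoly, hH]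
  have hz : ∀ k l, xyCoeff (F 0) k l = 2 * Complex.I * ((l + 1) * xyCoeff H k (l + 1)) := by
    intro k l
    rw [h0, ← xyCoeff_pderiv_one]
    exact MvPolynomial.coeff_C_mul _ _ _
  refine ⟨xyCoeff H, hc, hz, fun k l => ?_⟩
  rw [h1, xyCoeff_conjPoly, hz, map_mul, map_mul, map_mul, hc, map_add, map_natCast, map_one,
    Complex.conj_I, map_ofNat]
  ring

namespace HasHamiltonianCoeffs

variable {F : PolyField} {h : ℕ → ℕ → ℂ}

lemma mul_swap (hF : HasHamiltonianCoeffs F h) (k l : ℕ) :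
    h k l * h l k = ((‖h k l‖ ^ 2 : ℝ) : ℂ) := by
  rw [← hF.conj_eq k l, Complex.mul_conj, Complex.normSq_eq_norm_sq]

lemma norm_swap (hF : HasHamiltonianCoeffs F h) (k l : ℕ) : ‖h l k‖ = ‖h k l‖ := by
  rw [← hF.conj_eq k l, Complex.norm_conj]

lemma xLetter_eq (hF : HasHamiltonianCoeffs F h) (k l : ℕ) :
    xLetter F.toFormal k l = 2 * Complex.I * (l * h k l) := by
  obtain _ | l := l
  · simp [xLetter_zero_right]
  · rw [xLetter_succ, PolyField.toFormal, serCoeff_coe, hF.zero_eq]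
    push_cast; rfl

lemma yLetter_eq (hF : HasHamiltonianCoeffs F h) (k l : ℕ) :
    yLetter F.toFormal k l = -(2 * Complex.I * (k * h k l)) := by
  obtain _ | k := k
  · simp [yLetter_zero_left]
  · rw [yLetter_succ, PolyField.toFormal, serCoeff_coe, hF.one_eq]
    push_cast; rfl

end HasHamiltonianCoeffs

/-! ### Low-degree coefficients of the perturbed field -/

section Perturbed

variable {r : ℕ} {P : ℕ → MvPolynomial (Fin 2) ℂ}

lemma xyCoeff_linField_zero (k l : ℕ) :
    xyCoeff (linField 0) k l = if k = 1 ∧ l = 0 then Complex.I else 0 := by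
  change MvPolynomial.coeff (xyExp k l) (MvPolynomial.C Complex.I * MvPolynomial.X 0) = _
  rw [MvPolynomial.coeff_C_mul, MvPolynomial.coeff_X,
    show Finsupp.single (0 : Fin 2) 1 = xyExp 1 0 by simp [xyExp]]
  simp [xyExp_injective, eq_comm]

lemma xyCoeff_linField_one (k l : ℕ) :
    xyCoeff (linField 1) k l = if k = 0 ∧ l = 1 then -Complex.I else 0 := by
  change MvPolynomial.coeff (xyExp k l) (-(MvPolynomial.C Complex.I * MvPolynomial.X 1)) = _
  rw [MvPolynomial.coeff_neg, MvPolynomial.coeff_C_mul, MvPolynomial.coeff_X,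
    show Finsupp.single (1 : Fin 2) 1 = xyExp 0 1 by simp [xyExp]]
  simp only [xyExp_injective, @eq_comm _ 0 k, @eq_comm _ 1 l]
  split_ifs <;> simp

lemma xyCoeff_of_isHomogeneous {f : MvPolynomial (Fin 2) ℂ} {j k l : ℕ} (hf : f.IsHomogeneous j)
    (hkl : k + l ≠ j) : xyCoeff f k l = 0 :=
  hf.coeff_eq_zero (by rw [degree_xyExp]; exact hkl)

lemma xyCoeff_perturbedField_zero (hP : ∀ j ∈ Icc r (2 * r - 1), (P j).IsHomogeneous j)
    (k l : ℕ) : xyCoeff (perturbedField r P 0) k l = xyCoeff (linField 0) k l +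
      if k + l ∈ Icc r (2 * r - 1) then xyCoeff (P (k + l)) k l else 0 := by
  have : perturbedField r P 0 = linField 0 + ∑ j ∈ Icc r (2 * r - 1), P j := by
    simp [perturbedField, Finset.sum_apply]
  rw [this, xyCoeff_add]
  congr 1
  rw [xyCoeff, MvPolynomial.coeff_sum]
  rw [← sum_ite_eq (Icc r (2 * r - 1)) (k + l) fun j => xyCoeff (P j) k l]
  refine sum_congr rfl fun j hj => ?_
  split_ifs with hjk
  · rfl
  · exact xyCoeff_of_isHomogeneous (hP j hj) hjk

lemma coeff_linear (hr : 2 ≤ r)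
    (hP : ∀ j ∈ Icc r (2 * r - 1), (P j).IsHomogeneous j)
    (hF : IsRealHamiltonian (perturbedField r P)) (i : Fin 2) {k l : ℕ} (hkl : k + l ≤ 1) :
    xyCoeff (perturbedField r P i) k l = xyCoeff (linField i) k l := by
  have h0 : ∀ k l : ℕ, k + l ≤ 1 →
      xyCoeff (perturbedField r P 0) k l = xyCoeff (linField 0) k l := by
    intro k l hkl
    rw [xyCoeff_perturbedField_zero hP, if_neg (by rw [mem_Icc]; omega), add_zero]
  fin_cases i
  · exact h0 k l hkl
  · change xyCoeff (perturbedField r P 1) k l = xyCoeff (linField 1) k l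
    rw [hF.1, xyCoeff_conjPoly, h0 l k (by omega), xyCoeff_linField_zero, xyCoeff_linField_one]
    simp only [and_comm (a := l = 1)]
    split_ifs <;> simp

lemma coeff_component (hP : ∀ j ∈ Icc r (2 * r - 1), (P j).IsHomogeneous j)
    {k l : ℕ} (h2 : 2 ≤ k + l) (h3 : k + l ∈ Icc r (2 * r - 1)) :
    xyCoeff (perturbedField r P 0) k l = xyCoeff (P (k + l)) k l := by
  rw [xyCoeff_perturbedField_zero hP, xyCoeff_linField_zero, if_neg (by omega), zero_add,
    if_pos h3]

/-- The letter of h_kl lies in degree k + l - 1, and X has no terms of degree 2 to r - 1. The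
coefficients h_k0 are invisible in ∂H/∂y and follow by conjugation. -/
lemma HasHamiltonianCoeffs.eq_zero {h : ℕ → ℕ → ℂ}
    (hP : ∀ j ∈ Icc r (2 * r - 1), (P j).IsHomogeneous j)
    (hF : HasHamiltonianCoeffs (perturbedField r P) h) {k l : ℕ} (h3 : 3 ≤ k + l)
    (hkl : k + l ≤ r) : h k l = 0 := by
  have key : ∀ k l, 3 ≤ k + (l + 1) → k + (l + 1) ≤ r → h k (l + 1) = 0 := by
    intro k l h3 hkl
    have h1 := hF.zero_eq k l
    rw [xyCoeff_perturbedField_zero hP, xyCoeff_linField_zero, if_neg (by omega),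
      if_neg (by rw [mem_Icc]; omega), add_zero, eq_comm, mul_eq_zero] at h1
    have h2 := h1.resolve_left (mul_ne_zero two_ne_zero Complex.I_ne_zero)
    exact (mul_eq_zero.mp h2).resolve_left (Nat.cast_add_one_ne_zero l)
  obtain _ | l := l
  · obtain _ | k := k
    · omega
    · rw [← hF.conj_eq, key _ _ (by omega) (by omega), map_zero]
  · exact key k l h3 hkl

end Perturbed

/-! ### The sum S in terms of the Hamiltonian -/

/-- The quadratic resonant sum of a Hamiltonian perturbation, symmetrised. -/
lemma sum_quadratic (r : ℕ) (ι : ℂ) (N : ℕ → ℕ → ℂ) (hN : ∀ k l, N l k = N k l) :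
    ∑ x ∈ antidiagonal (r + 1),
      -4 * N x.1 x.2 * ((x.2 : ℂ) * x.2 - x.1 * ((x.1 : ℂ) - 1)) * x.1 / (ι * ((x.2 : ℂ) - x.1)) =
    -ι⁻¹ * ∑ x ∈ antidiagonal (r + 1),
      if x.1 = x.2 then 0 else 2 * r * (r + 1) * N x.1 x.2 := by
  set g : ℕ × ℕ → ℂ := fun x =>
    -4 * N x.1 x.2 * ((x.2 : ℂ) * x.2 - x.1 * ((x.1 : ℂ) - 1)) * x.1 / (ι * ((x.2 : ℂ) - x.1))
    with hg
  have hs : ∑ x ∈ antidiagonal (r + 1), g x = ∑ x ∈ antidiagonal (r + 1), g x.swap :=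
    (Nat.sum_antidiagonal_swap (n := r + 1) (f := g)).symm
  -- The two numerators combine to (l - k)(k + l)(k + l - 1) = (l - k)(r + 1)r, which cancels the
  -- divisor.
  have h2 : ∑ x ∈ antidiagonal (r + 1), (g x + g x.swap) =
      2 * (-ι⁻¹ * ∑ x ∈ antidiagonal (r + 1),
        if x.1 = x.2 then 0 else 2 * r * (r + 1) * N x.1 x.2) := by
    rw [mul_sum, mul_sum]
    refine sum_congr rfl ?_
    rintro ⟨k, l⟩ hx
    rw [HasAntidiagonal.mem_antidiagonal] at hx
    simp only [hg, Prod.swap, hN k l] at hx ⊢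
    split_ifs with hkl
    -- On the diagonal the divisor is zero, and division by zero gives the required value 0.
    · simp [hkl]
    have hr : (r : ℂ) = k + l - 1 := by
      have : ((k + l : ℕ) : ℂ) = ((r + 1 : ℕ) : ℂ) := by rw [hx]
      push_cast at this
      linear_combination -this
    have hne : (l : ℂ) - k ≠ 0 := sub_ne_zero.2 fun h => hkl (by exact_mod_cast h.symm)
    by_cases hι : ι = 0
    · simp [hι]
    rw [hr, show (k : ℂ) - l = -(l - k) by ring]
    field_simp
    ring
  rw [sum_add_distrib, ← hs] at h2
  linear_combination h2 / 2

lemma sum_antidiagonal_offDiag (n : ℕ) (g : ℕ → ℕ → ℝ) (hg : ∀ k l, g l k = g k l) :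
    ∑ x ∈ antidiagonal n, (if x.1 = x.2 then 0 else g x.1 x.2) =
      2 * ∑ k ∈ Icc (n / 2 + 1) n, g k (n - k) := by
  have h1 : ∑ k ∈ Icc (n / 2 + 1) n, g k (n - k) =
      ∑ x ∈ antidiagonal n, if x.2 < x.1 then g x.1 x.2 else 0 := by
    rw [← sum_filter]
    refine sum_nbij' (fun k => (k, n - k)) Prod.fst ?_ ?_ ?_ ?_ ?_
    · intro k hk
      rw [mem_Icc] at hk
      simp only [mem_filter, HasAntidiagonal.mem_antidiagonal]
      omega
    · rintro ⟨k, l⟩ hk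
      simp only [mem_filter, HasAntidiagonal.mem_antidiagonal] at hk
      rw [mem_Icc]
      omega
    · simp
    · rintro ⟨k, l⟩ hk
      simp only [mem_filter, HasAntidiagonal.mem_antidiagonal] at hk
      exact Prod.ext rfl (by dsimp only; omega)
    · simp
  have h2 := Nat.sum_antidiagonal_swap (n := n)
    (f := fun x : ℕ × ℕ => if x.2 < x.1 then g x.1 x.2 else 0)
  rw [two_mul, h1]
  nth_rw 1 [← h2]
  rw [← sum_add_distrib]
  refine sum_congr rfl ?_
  rintro ⟨k, l⟩ -
  simp only [Prod.swap]
  rcases lt_trichotomy k l with h | h | h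
  · rw [if_neg h.ne, if_pos h, if_neg h.not_gt, hg, add_zero]
  · simp [h]
  · rw [if_neg h.ne', if_neg h.not_gt, if_pos h, zero_add]

/-- The Birkhoff sum in terms of the coefficients of the Hamiltonian. -/
lemma birkhoffSum_eq {r : ℕ} {P : ℕ → MvPolynomial (Fin 2) ℂ} {h : ℕ → ℕ → ℂ} (hr : 2 ≤ r)
    (hP : ∀ j ∈ Icc r (2 * r - 1), (P j).IsHomogeneous j)
    (hF : HasHamiltonianCoeffs (perturbedField r P) h) :
    birkhoffSum r (P r) = ∑ x ∈ antidiagonal (r + 1),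
      if x.1 = x.2 then 0 else 2 * r * (r + 1) * ‖h x.1 x.2‖ ^ 2 := by
  have hc : ∀ k ≤ r, ‖xyCoeff (P r) k (r - k)‖ = 2 * ((r : ℝ) - k + 1) * ‖h k (r + 1 - k)‖ := by
    intro k hk
    have h1 := coeff_component hP (k := k) (l := r - k) (by omega) (by rw [mem_Icc]; omega)
    rw [Nat.add_sub_cancel' hk] at h1
    rw [← h1, hF.zero_eq, show r - k + 1 = r + 1 - k by omega, norm_mul, norm_mul, norm_mul]
    have : ‖((r - k : ℕ) : ℂ) + 1‖ = (r : ℝ) - k + 1 := by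
      rw [← Nat.cast_sub hk, ← Nat.cast_add_one, Complex.norm_natCast, Nat.cast_add_one]
    rw [this]
    simp
    ring
  -- Folding the sum onto k > l leaves k up to r + 1. The top index is the term in p_{-1,r}, since
  -- |h_{r+1,0}| = |h_{0,r+1}|.
  rw [sum_antidiagonal_offDiag (r + 1) (fun k l => 2 * r * (r + 1) * ‖h k l‖ ^ 2)
    (fun k l => by rw [hF.norm_swap]), sum_Icc_succ_top (by omega), mul_add, mul_sum, birkhoffSum]
  congr 1
  · refine sum_congr rfl fun k hk => ?_
    rw [mem_Icc] at hk
    rw [hc k hk.2]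
    have : (r : ℝ) - k + 1 ≠ 0 := by
      have : (k : ℝ) ≤ r := by exact_mod_cast hk.2
      linarith
    field_simp
  · have := hc 0 (Nat.zero_le _)
    rw [Nat.sub_zero, Nat.sub_zero] at this
    rw [this, Nat.sub_self, hF.norm_swap (r + 1) 0]
    have : (r : ℝ) + 1 ≠ 0 := by positivity
    push_cast
    rw [sub_zero]
    field_simp

/-! ### The correction in degree 2r - 1 and the obstruction -/

section

variable {r : ℕ} {P : ℕ → MvPolynomial (Fin 2) ℂ} {h : ℕ → ℕ → ℂ} {Z : FormalField}

/-- The nonlinear part of the vector field `A - Z`. -/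
def remainder (F : PolyField) (Z : FormalField) : FormalField :=
  F.toFormal - Z - linField.toFormal

lemma xLetter_sub (A B : FormalField) (k l : ℕ) :
    xLetter (A - B) k l = xLetter A k l - xLetter B k l := by
  rw [xLetter, Pi.sub_apply, mul_sub, serCoeff_sub, xLetter, xLetter]

lemma yLetter_sub (A B : FormalField) (k l : ℕ) :
    yLetter (A - B) k l = yLetter A k l - yLetter B k l := by
  rw [yLetter, Pi.sub_apply, mul_sub, serCoeff_sub, yLetter, yLetter]

lemma xLetter_linField {k l : ℕ} (hkl : 3 ≤ k + l) : xLetter linField.toFormal k l = 0 := by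
  obtain _ | l := l
  · exact xLetter_zero_right _ _
  · rw [xLetter_succ, PolyField.toFormal, serCoeff_coe, xyCoeff_linField_zero, if_neg (by omega)]

lemma yLetter_linField {k l : ℕ} (hkl : 3 ≤ k + l) : yLetter linField.toFormal k l = 0 := by
  obtain _ | k := k
  · exact yLetter_zero_left _ _
  · rw [yLetter_succ, PolyField.toFormal, serCoeff_coe, xyCoeff_linField_one, if_neg (by omega)]

lemma coeff_remainder_eq_zero (hr : 2 ≤ r)
    (hP : ∀ j ∈ Icc r (2 * r - 1), (P j).IsHomogeneous j)
    (hF : IsRealHamiltonian (perturbedField r P))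
    (hZ : ∀ i, ∀ m : Fin 2 →₀ ℕ, m.degree ≤ 1 → MvPowerSeries.coeff m (Z i) = 0)
    (i : Fin 2) (m : Fin 2 →₀ ℕ) (hm : m.degree ≤ 1) :
    MvPowerSeries.coeff m (remainder (perturbedField r P) Z i) = 0 := by
  have hc := coeff_linear hr hP hF i (k := m 0) (l := m 1)
    (by rwa [Finsupp.degree_eq_sum, Fin.sum_univ_two] at hm)
  rw [← serCoeff_coe, ← serCoeff_coe, serCoeff, serCoeff, ← eq_xyExp] at hc
  simp only [remainder, Pi.sub_apply, map_sub, hZ i m hm, PolyField.toFormal, hc, sub_zero,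
    sub_self]

lemma letters_of_bracket (hZ : lieBracket linField.toFormal Z = 0) {k l : ℕ} (hkl : k ≠ l) :
    xLetter Z k l = 0 ∧ yLetter Z k l = 0 := by
  constructor
  · obtain _ | l := l
    · exact xLetter_zero_right _ _
    · rw [xLetter_succ]
      exact (serCoeff_eq_zero_of_bracket hZ k l).1 hkl
  · obtain _ | k := k
    · exact yLetter_zero_left _ _
    · rw [yLetter_succ]
      exact (serCoeff_eq_zero_of_bracket hZ k l).2 hkl.symm

lemma letters_remainder (hF : HasHamiltonianCoeffs (perturbedField r P) h) {k l : ℕ}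
    (hkl : 3 ≤ k + l) :
    xLetter (remainder (perturbedField r P) Z) k l =
        2 * Complex.I * (l * h k l) - xLetter Z k l ∧
      yLetter (remainder (perturbedField r P) Z) k l =
        -(2 * Complex.I * (k * h k l)) - yLetter Z k l := by
  rw [remainder, xLetter_sub, xLetter_sub, yLetter_sub, yLetter_sub, hF.xLetter_eq, hF.yLetter_eq,
    xLetter_linField hkl, yLetter_linField hkl]
  simp

/-- The resonant letters of a correction up to size `2 r`. -/
lemma letters_correction (hr : 2 ≤ r)
    (hP : ∀ j ∈ Icc r (2 * r - 1), (P j).IsHomogeneous j)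
    (hH : IsRealHamiltonian (perturbedField r P))
    (hF : HasHamiltonianCoeffs (perturbedField r P) h)
    (hZ : IsCorrection (perturbedField r P).toFormal Z) :
    (∀ k, 2 ≤ k → k < r → xLetter Z k k = 2 * Complex.I * (k * h k k)) ∧
      xLetter Z r r = 2 * Complex.I * (r * h r r) - Complex.I * birkhoffSum r (P r) ∧
      yLetter Z r r = -(2 * Complex.I * (r * h r r)) + Complex.I * birkhoffSum r (P r) := by
  obtain ⟨hZ1, hZ2, hZ3⟩ := hZ
  set Y := remainder (perturbedField r P) Z with hYdef
  have hY := coeff_remainder_eq_zero hr hP hH hZ1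
  rw [show (perturbedField r P).toFormal - Z = linField.toFormal + Y by
    rw [hYdef, remainder]; abel] at hZ3
  obtain ⟨⟨f, hf⟩, ⟨g, hg⟩⟩ := hZ3.exists_eigenFamilies hY
  have hnr : ∀ c d, c ≠ d → c + d ≤ r → xLetter Y c d = 0 ∧ yLetter Y c d = 0 := by
    intro c d hcd hs
    rcases Nat.lt_or_ge (c + d) 3 with h3 | h3
    · exact letters_of_order hY (by omega)
    · obtain ⟨e1, e2⟩ := letters_remainder (Z := Z) hF h3
      obtain ⟨e3, e4⟩ := letters_of_bracket hZ2 hcd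
      rw [e1, e2, e3, e4, hF.eq_zero hP h3 hs]
      simp
  have hnr' : ∀ c d, c ≠ d → c + d ≤ r → yLetter Y d c = 0 ∧ xLetter Y d c = 0 :=
    fun c d hcd hs => (hnr d c hcd.symm (by omega)).symm
  -- Both eigenfunctions are needed: one controls the x-letters, the other the y-letters, and each
  -- inductive step uses both families below k.
  have hres : ∀ k < r, xLetter Y k k = 0 ∧ yLetter Y k k = 0 := by
    intro k
    induction k using Nat.strong_induction_on with
    | _ k ih =>
      intro hk
      exact ⟨hf.resonant_eq_zero hr hk hnr fun c hc => ih c hc (hc.trans hk),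
        hg.resonant_eq_zero hr hk hnr' fun c hc => (ih c hc (hc.trans hk)).symm⟩
  have hS : ∀ ι : ℂ, ∑ x ∈ antidiagonal (r + 1),
      -4 * (h x.1 x.2 * h x.2 x.1) * ((x.2 : ℂ) * x.2 - x.1 * ((x.1 : ℂ) - 1)) * x.1 /
        (ι * ((x.2 : ℂ) - x.1)) = -ι⁻¹ * birkhoffSum r (P r) := by
    intro ι
    rw [sum_quadratic r ι (fun k l => h k l * h l k) (fun k l => mul_comm _ _),
      birkhoffSum_eq hr hP hF]
    push_cast
    congr 1
    refine sum_congr rfl fun x _ => ?_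
    rw [hF.mul_swap]
    push_cast
    split_ifs <;> simp
  have hoff : ∀ k l, k ≠ l → k + l = r + 1 → xLetter Y k l = 2 * Complex.I * (l * h k l) ∧
      yLetter Y k l = -(2 * Complex.I * (k * h k l)) := by
    intro k l hkl hs
    obtain ⟨e1, e2⟩ := letters_remainder (Z := Z) hF (k := k) (l := l) (by omega)
    obtain ⟨e3, e4⟩ := letters_of_bracket hZ2 hkl
    rw [← hYdef] at e1 e2
    rw [e1, e2, e3, e4, sub_zero, sub_zero]
    exact ⟨rfl, rfl⟩
  have hx : xLetter Y r r = Complex.I * birkhoffSum r (P r) := by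
    rw [hf.resonant_eq hr hnr hres,
      show Complex.I * (birkhoffSum r (P r) : ℂ) = -Complex.I⁻¹ * birkhoffSum r (P r) by simp, ← hS]
    refine sum_congr rfl ?_
    rintro ⟨k, l⟩ hkl
    rw [HasAntidiagonal.mem_antidiagonal] at hkl
    dsimp only at hkl ⊢
    by_cases he : k = l
    · simp [he]
    · obtain ⟨e1, e2⟩ := hoff k l he hkl
      obtain ⟨e3, -⟩ := hoff l k (Ne.symm he) (by omega)
      rw [e1, e2, e3]
      congr 1
      linear_combination 4 * h k l * h l k * k * ((l : ℂ) * l - k * (k - 1)) * Complex.I_sq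
  have hy : yLetter Y r r = -Complex.I * birkhoffSum r (P r) := by
    rw [hg.resonant_eq hr hnr' fun c hc => (hres c hc).symm,
      show -Complex.I * (birkhoffSum r (P r) : ℂ) = -(-Complex.I)⁻¹ * birkhoffSum r (P r) by simp,
      ← hS]
    refine sum_congr rfl ?_
    rintro ⟨k, l⟩ hkl
    rw [HasAntidiagonal.mem_antidiagonal] at hkl
    dsimp only at hkl ⊢
    by_cases he : k = l
    · simp [he]
    · obtain ⟨-, e1⟩ := hoff k l he hkl
      obtain ⟨e3, e2⟩ := hoff l k (Ne.symm he) (by omega)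
      rw [e1, e2, e3]
      congr 1
      linear_combination 4 * h k l * h l k * k * ((l : ℂ) * l - k * (k - 1)) * Complex.I_sq
  obtain ⟨e1, e2⟩ := letters_remainder (Z := Z) hF (k := r) (l := r) (by omega)
  refine ⟨fun k h2 hk => ?_, ?_, ?_⟩
  · obtain ⟨e1, -⟩ := letters_remainder (Z := Z) hF (k := k) (l := k) (by omega)
    linear_combination e1 - (hres k hk).1
  · linear_combination e1 - hx
  · linear_combination e2 - hy

lemma resonantField_zero (m : ℕ) (c : ℂ) :
    resonantField m c 0 = MvPolynomial.monomial (xyExp (m + 1) m) c := by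
  have e : xyExp (m + 1) m = xyExp m m + Finsupp.single 0 1 := by
    simp only [xyExp, Finsupp.single_add]; abel
  rw [e, ← mul_one c, ← MvPolynomial.monomial_mul]
  simp [resonantField, xyExp, MvPolynomial.X, MvPolynomial.monomial_pow,
    MvPolynomial.C_mul_monomial, MvPolynomial.monomial_mul]

lemma resonantField_one (m : ℕ) (c : ℂ) :
    resonantField m c 1 = MvPolynomial.monomial (xyExp m (m + 1)) (starRingEnd ℂ c) := by
  have e : xyExp m (m + 1) = xyExp m m + Finsupp.single 1 1 := by
    simp only [xyExp, Finsupp.single_add]; abel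
  rw [e, ← mul_one (starRingEnd ℂ c), ← MvPolynomial.monomial_mul]
  simp [resonantField, xyExp, MvPolynomial.X, MvPolynomial.monomial_pow,
    MvPolynomial.C_mul_monomial, MvPolynomial.monomial_mul]

lemma coeff_top (hr : 2 ≤ r) (hP : ∀ j ∈ Icc r (2 * r - 1), (P j).IsHomogeneous j)
    (hF : HasHamiltonianCoeffs (perturbedField r P) h) :
    xyCoeff (P (2 * r - 1)) r (r - 1) = 2 * Complex.I * (r * h r r) := by
  have h1 := coeff_component hP (k := r) (l := r - 1) (by omega) (by rw [mem_Icc]; omega)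
  rw [show r + (r - 1) = 2 * r - 1 by omega] at h1
  rw [← h1, hF.zero_eq, Nat.sub_add_cancel (by omega : 1 ≤ r), Nat.cast_sub (by omega)]
  push_cast
  ring

lemma conj_coeff_top (hF : HasHamiltonianCoeffs (perturbedField r P) h) :
    starRingEnd ℂ (2 * Complex.I * (r * h r r)) = -(2 * Complex.I * (r * h r r)) := by
  rw [map_mul, map_mul, map_mul, hF.conj_eq, Complex.conj_I, map_natCast, map_ofNat]
  ring

lemma homogeneousComponent_correction (hr : 2 ≤ r)
    (hP : ∀ j ∈ Icc r (2 * r - 1), (P j).IsHomogeneous j)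
    (hH : IsRealHamiltonian (perturbedField r P))
    (hZ : IsCorrection (perturbedField r P).toFormal Z) (i : Fin 2) :
    MvPowerSeries.homogeneousComponent (2 * r - 1) (Z i) =
      (resonantField (r - 1) (xyCoeff (P (2 * r - 1)) r (r - 1) -
        Complex.I * birkhoffSum r (P r))).toFormal i := by
  classical
  obtain ⟨h, hF⟩ := hH.exists_coeffs
  obtain ⟨-, hx, hy⟩ := letters_correction hr hP hH hF hZ
  obtain ⟨-, hZ2, -⟩ := hZ
  obtain ⟨s, rfl⟩ : ∃ s, r = s + 1 := ⟨r - 1, by omega⟩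
  rw [coeff_top hr hP hF]
  ext m
  rw [MvPowerSeries.coeff_homogeneousComponent, PolyField.toFormal, MvPolynomial.coeff_coe,
    eq_xyExp m, degree_xyExp]
  set p := m 0
  set q := m 1
  fin_cases i
  · change (if p + q = _ then serCoeff (Z 0) p q else 0) = MvPolynomial.coeff _ (resonantField _ _ 0)
    rw [resonantField_zero, MvPolynomial.coeff_monomial, Nat.add_sub_cancel]
    by_cases hpq : p = q + 1
    · by_cases hs : q = s
      · rw [hpq, hs, if_pos (by omega), if_pos rfl, ← xLetter_succ, hx]
      · rw [if_neg (by omega), if_neg (by rw [xyExp_injective]; omega)]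
    · rw [(serCoeff_eq_zero_of_bracket hZ2 p q).1 hpq, ite_self,
        if_neg (by rw [xyExp_injective]; omega)]
  · change (if p + q = _ then serCoeff (Z 1) p q else 0) = MvPolynomial.coeff _ (resonantField _ _ 1)
    rw [resonantField_one, MvPolynomial.coeff_monomial, Nat.add_sub_cancel, map_sub,
      conj_coeff_top hF, map_mul, Complex.conj_I, Complex.conj_ofReal]
    by_cases hpq : q = p + 1
    · by_cases hs : p = s
      · rw [hpq, hs, if_pos (by omega), if_pos rfl, ← yLetter_succ, hy]
        ring
      · rw [if_neg (by omega), if_neg (by rw [xyExp_injective]; omega)]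
    · rw [(serCoeff_eq_zero_of_bracket hZ2 p q).2 hpq, ite_self,
        if_neg (by rw [xyExp_injective]; omega)]

lemma birkhoffSum_nonneg (r : ℕ) (f : MvPolynomial (Fin 2) ℂ) : 0 ≤ birkhoffSum r f := by
  rw [birkhoffSum]
  exact add_nonneg (sum_nonneg fun k _ => by positivity) (by positivity)

/-- `0` is a correction of a linearisable field. -/
lemma IsLinearisable.isCorrection_zero {A : FormalField} (hA : IsLinearisable A) :
    IsCorrection A 0 := by
  refine ⟨fun _ _ _ => by simp, ?_, by rwa [sub_zero]⟩
  funext i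
  simp [lieBracket]

lemma eq_birkhoffSum_of_isLinearisable (hr : 2 ≤ r)
    (hP : ∀ j ∈ Icc r (2 * r - 1), (P j).IsHomogeneous j)
    (hH : IsRealHamiltonian (perturbedField r P))
    (hL : IsLinearisable (perturbedField r P).toFormal) :
    xyCoeff (P (2 * r - 1)) r (r - 1) = Complex.I * birkhoffSum r (P r) ∧
      (birkhoffSum r (P r) = 0 → P r = 0) := by
  obtain ⟨h, hF⟩ := hH.exists_coeffs
  obtain ⟨hlow, hx, -⟩ := letters_correction hr hP hH hF hL.isCorrection_zero
  have h0 : ∀ k, xLetter (0 : FormalField) k k = 0 := fun k => by simp [xLetter, serCoeff]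
  refine ⟨?_, fun hS => ?_⟩
  · rw [coeff_top hr hP hF]
    linear_combination h0 r - hx
  -- For odd r the middle coefficient k = l does not occur in S. It is a resonant term of lower
  -- degree, already killed because Z = 0.
  have hh : ∀ k l, k + l = r + 1 → h k l = 0 := by
    intro k l hkl
    by_cases he : k = l
    · subst he
      have h1 := hlow k (by omega) (by omega)
      rw [h0, eq_comm, mul_eq_zero] at h1
      have h2 := h1.resolve_left (mul_ne_zero two_ne_zero Complex.I_ne_zero)
      exact (mul_eq_zero.mp h2).resolve_left (by exact_mod_cast (by omega : k ≠ 0))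
    · rw [birkhoffSum_eq hr hP hF, sum_eq_zero_iff_of_nonneg
        (fun x _ => by split_ifs <;> positivity)] at hS
      have h1 := hS (k, l) (HasAntidiagonal.mem_antidiagonal.2 hkl)
      rw [if_neg he] at h1
      have hr0 : (r : ℝ) ≠ 0 := by exact_mod_cast (by omega : r ≠ 0)
      have hr1 : (r : ℝ) + 1 ≠ 0 := by positivity
      simpa [hr0, hr1] using h1
  ext m
  rw [eq_xyExp m, MvPolynomial.coeff_zero]
  change xyCoeff (P r) (m 0) (m 1) = 0
  by_cases hm : m 0 + m 1 = r
  · have h1 := coeff_component hP (k := m 0) (l := m 1) (by omega) (by rw [mem_Icc]; omega)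
    rw [hm] at h1
    rw [← h1, hF.zero_eq, hh _ _ (by omega), mul_zero, mul_zero]
  · exact xyCoeff_of_isHomogeneous (hP r (by rw [mem_Icc]; omega)) hm

end

/-! ### Hamiltonian derivations and their commutators -/

section

variable {r : ℕ} {P : ℕ → MvPolynomial (Fin 2) ℂ} {h : ℕ → ℕ → ℂ} {F : PolyField}

lemma pderiv_comm (i j : Fin 2) (f : MvPolynomial (Fin 2) ℂ) :
    MvPolynomial.pderiv i (MvPolynomial.pderiv j f) =
      MvPolynomial.pderiv j (MvPolynomial.pderiv i f) := by
  have : ⁅MvPolynomial.pderiv (R := ℂ) i, MvPolynomial.pderiv (R := ℂ) j⁆ = 0 := by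
    refine MvPolynomial.derivation_ext fun k => ?_
    rw [Derivation.commutator_apply]
    simp [MvPolynomial.pderiv_X, Pi.single_apply, apply_ite]
  have h1 := congrArg (fun D : Derivation ℂ (MvPolynomial (Fin 2) ℂ) (MvPolynomial (Fin 2) ℂ) =>
    D f) this
  simpa [Derivation.commutator_apply, sub_eq_zero] using h1

/-- The Hamiltonian derivation `f ↦ ∂M/∂y ∂f/∂x - ∂M/∂x ∂f/∂y`. -/
def hamDerivation (M : MvPolynomial (Fin 2) ℂ) :
    Derivation ℂ (MvPolynomial (Fin 2) ℂ) (MvPolynomial (Fin 2) ℂ) :=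
  MvPolynomial.mkDerivation ℂ ![MvPolynomial.pderiv 1 M, -MvPolynomial.pderiv 0 M]

lemma hamDerivation_X_zero (M : MvPolynomial (Fin 2) ℂ) :
    hamDerivation M (MvPolynomial.X 0) = MvPolynomial.pderiv 1 M := by simp [hamDerivation]

lemma hamDerivation_X_one (M : MvPolynomial (Fin 2) ℂ) :
    hamDerivation M (MvPolynomial.X 1) = -MvPolynomial.pderiv 0 M := by simp [hamDerivation]

lemma hamDerivation_apply (M f : MvPolynomial (Fin 2) ℂ) :
    hamDerivation M f = MvPolynomial.pderiv 1 M * MvPolynomial.pderiv 0 f -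
      MvPolynomial.pderiv 0 M * MvPolynomial.pderiv 1 f := by
  have : hamDerivation M = MvPolynomial.pderiv 1 M • MvPolynomial.pderiv 0 -
      MvPolynomial.pderiv 0 M • MvPolynomial.pderiv 1 := by
    refine MvPolynomial.derivation_ext fun k => ?_
    fin_cases k
    · simp [hamDerivation]
    · simp [hamDerivation]
  rw [this]
  rfl

lemma hamDerivation_smul (c : ℂ) (M : MvPolynomial (Fin 2) ℂ) :
    hamDerivation (c • M) = c • hamDerivation M := by
  refine MvPolynomial.derivation_ext fun k => ?_
  rw [Derivation.smul_apply, hamDerivation_apply, hamDerivation_apply]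
  simp [smul_sub]

/-- This is the Jacobi identity for the Poisson bracket, checked on the two coordinates. -/
lemma hamDerivation_bracket (M N : MvPolynomial (Fin 2) ℂ) :
    ⁅hamDerivation M, hamDerivation N⁆ = hamDerivation (hamDerivation M N) := by
  refine MvPolynomial.derivation_ext fun k => ?_
  rw [Derivation.commutator_apply]
  fin_cases k
  · change hamDerivation M (hamDerivation N (MvPolynomial.X 0)) -
      hamDerivation N (hamDerivation M (MvPolynomial.X 0)) =
      hamDerivation (hamDerivation M N) (MvPolynomial.X 0)
    simp only [hamDerivation_X_zero]
    simp only [hamDerivation_apply, map_sub, Derivation.leibniz, smul_eq_mul, pderiv_comm 0 1]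
    ring
  · change hamDerivation M (hamDerivation N (MvPolynomial.X 1)) -
      hamDerivation N (hamDerivation M (MvPolynomial.X 1)) =
      hamDerivation (hamDerivation M N) (MvPolynomial.X 1)
    simp only [hamDerivation_X_one]
    simp only [hamDerivation_apply, map_sub, map_neg, Derivation.leibniz, smul_eq_mul,
      pderiv_comm 1 0]
    ring

/-- The monomial `x ^ k * y ^ l`. -/
def xyMonomial (k l : ℕ) : MvPolynomial (Fin 2) ℂ := MvPolynomial.X 0 ^ k * MvPolynomial.X 1 ^ l

lemma pderiv_zero_xyMonomial (k l : ℕ) : MvPolynomial.pderiv 0 (xyMonomial k l) =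
    MvPolynomial.C (k : ℂ) * xyMonomial (k - 1) l := by
  simp [xyMonomial]
  ring

lemma pderiv_one_xyMonomial (k l : ℕ) : MvPolynomial.pderiv 1 (xyMonomial k l) =
    MvPolynomial.C (l : ℂ) * xyMonomial k (l - 1) := by
  simp [xyMonomial]
  ring

lemma hamDerivation_xyMonomial_swap {k l : ℕ} (hkl : k + l = r + 1) :
    hamDerivation (xyMonomial k l) (xyMonomial l k) =
      ((l : ℂ) * l - k * k) • xyMonomial r r := by
  have h1 : ∀ a b : ℕ, a + b = r + 1 → MvPolynomial.C (b : ℂ) * xyMonomial a (b - 1) *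
      (MvPolynomial.C (b : ℂ) * xyMonomial (b - 1) a) =
      MvPolynomial.C ((b : ℂ) * b) * xyMonomial r r := by
    intro a b hab
    obtain _ | b := b
    · simp
    · obtain rfl : r = a + b := by omega
      simp only [xyMonomial, Nat.add_sub_cancel, MvPolynomial.C_mul]
      ring
  rw [hamDerivation_apply, pderiv_zero_xyMonomial, pderiv_zero_xyMonomial, pderiv_one_xyMonomial,
    pderiv_one_xyMonomial, h1 k l hkl, mul_comm (xyMonomial (k - 1) l |> (MvPolynomial.C (k : ℂ) * ·)),
    h1 l k (by omega), MvPolynomial.smul_eq_C_mul, map_sub, sub_mul]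

/-! ### The mould series in depth 2(r - 1) -/

/-- The letter `(k - 1, l - 1)`. -/
def letter (k l : ℕ) : Letter := ((k : ℤ) - 1, (l : ℤ) - 1)

lemma letterDepth_letter (k l : ℕ) : letterDepth (letter k l) = k + l - 2 := by
  simp only [letterDepth, letter]; ring

lemma weight_letter (k l : ℕ) : weight (letter k l) = Complex.I * ((k : ℂ) - l) := by
  simp only [weight, letter]; push_cast; ring

lemma mem_alphabet {d : ℕ} {n : Letter} :
    n ∈ alphabet d ↔ ∃ k l : ℕ, 3 ≤ k + l ∧ k + l ≤ d + 2 ∧ n = letter k l := by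
  simp only [alphabet, mem_biUnion, mem_Icc, lettersOfDegree, mem_image, mem_range, letter]
  constructor
  · rintro ⟨j, hj, k, hk, rfl⟩
    exact ⟨k, j + 1 - k, by omega, by omega, Prod.ext rfl (by dsimp only; omega)⟩
  · rintro ⟨k, l, h3, hd, rfl⟩
    exact ⟨k + l - 1, by omega, k, by omega, Prod.ext rfl (by dsimp only; omega)⟩

lemma homOperator_letter (hF : HasHamiltonianCoeffs F h) (k l : ℕ) :
    homOperator F (letter k l) =
      ((2 * Complex.I * h k l) • hamDerivation (xyMonomial k l)).toLinearMap := by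
  rw [homOperator]
  congr 1
  refine MvPolynomial.derivation_ext fun i => ?_
  rw [Derivation.smul_apply]
  fin_cases i
  · change _ = _ • hamDerivation (xyMonomial k l) (MvPolynomial.X 0)
    rw [MvPolynomial.mkDerivation_X, hamDerivation_X_zero, pderiv_one_xyMonomial]
    change monomialPart (F 0) ((k : ℤ) - 1 + 1) ((l : ℤ) - 1) = _
    obtain _ | l := l
    · rw [monomialPart, if_neg (by omega)]; simp
    · rw [monomialPart, if_pos (by omega), show ((k : ℤ) - 1 + 1).toNat = k by omega,
        show (((l + 1 : ℕ) : ℤ) - 1).toNat = l by omega, hF.zero_eq, xyMonomial,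
        MvPolynomial.smul_eq_C_mul, Nat.add_sub_cancel]
      simp only [map_mul]
      push_cast
      ring
  · change _ = _ • hamDerivation (xyMonomial k l) (MvPolynomial.X 1)
    rw [MvPolynomial.mkDerivation_X, hamDerivation_X_one, pderiv_zero_xyMonomial]
    change monomialPart (F 1) ((k : ℤ) - 1) ((l : ℤ) - 1 + 1) = _
    obtain _ | k := k
    · rw [monomialPart, if_neg (by omega)]; simp
    · rw [monomialPart, if_pos (by omega), show ((l : ℤ) - 1 + 1).toNat = l by omega,
        show (((k + 1 : ℕ) : ℤ) - 1).toNat = k by omega, hF.one_eq, xyMonomial,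
        MvPolynomial.smul_eq_C_mul, Nat.add_sub_cancel]
      simp only [map_mul, map_neg]
      push_cast
      ring

lemma homOperator_commutator (hF : HasHamiltonianCoeffs F h) {k l : ℕ} (hkl : k + l = r + 1) :
    homOperator F (letter k l) * homOperator F (letter l k) -
      homOperator F (letter l k) * homOperator F (letter k l) =
      (-4 * (h k l * h l k) * ((l : ℂ) * l - k * k)) •
        (hamDerivation (xyMonomial r r)).toLinearMap := by
  have h1 := hamDerivation_bracket (xyMonomial k l) (xyMonomial l k)
  rw [hamDerivation_xyMonomial_swap hkl, hamDerivation_smul] at h1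
  refine LinearMap.ext fun f => ?_
  have h2 := congrArg (fun D : Derivation ℂ (MvPolynomial (Fin 2) ℂ) (MvPolynomial (Fin 2) ℂ) =>
    D f) h1
  simp only [Derivation.commutator_apply, Derivation.smul_apply] at h2
  rw [homOperator_letter hF, homOperator_letter hF]
  change (2 * Complex.I * h k l) • hamDerivation (xyMonomial k l)
      ((2 * Complex.I * h l k) • hamDerivation (xyMonomial l k) f) -
    (2 * Complex.I * h l k) • hamDerivation (xyMonomial l k)
      ((2 * Complex.I * h k l) • hamDerivation (xyMonomial k l) f) =
    (-4 * (h k l * h l k) * ((l : ℂ) * l - k * k)) • hamDerivation (xyMonomial r r) f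
  rw [Derivation.map_smul, Derivation.map_smul, mul_smul (-4 * (h k l * h l k)), ← h2, smul_sub, smul_smul, smul_smul]
  have e : -4 * (h k l * h l k) = 2 * Complex.I * h k l * (2 * Complex.I * h l k) := by
    linear_combination -4 * (h k l * h l k) * Complex.I_sq
  rw [e, mul_comm (2 * Complex.I * h l k)]

lemma carrMould_letter (n : Letter) : carrMould [n] = if weight n = 0 then 1 else 0 := by
  rw [carrMould]

/-- For nonresonant n the product term Carr^n Carr^m of the variance formula vanishes. -/
lemma carrMould_pair (n m : Letter) : carrMould [n, m] =
    if weight n = 0 then 0 else -(if weight (n + m) = 0 then 1 else 0) / weight n := by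
  rw [carrMould]
  by_cases h1 : weight n = 0
  · rw [if_pos h1, if_pos h1]
  · rw [if_neg h1, if_neg h1]
    simp [carrMould_letter, h1]

lemma weight_letter_eq_zero {k l : ℕ} : weight (letter k l) = 0 ↔ k = l := by
  rw [weight_letter, mul_eq_zero, sub_eq_zero, Nat.cast_inj]
  simp

lemma homOperator_eq_zero (hP : ∀ j ∈ Icc r (2 * r - 1), (P j).IsHomogeneous j)
    (hF : HasHamiltonianCoeffs (perturbedField r P) h) {k l : ℕ} (h3 : 3 ≤ k + l)
    (hkl : k + l ≤ r) : homOperator (perturbedField r P) (letter k l) = 0 := by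
  rw [homOperator_letter hF, hF.eq_zero hP h3 hkl, mul_zero, zero_smul]
  rfl

lemma wordOperator_eq_zero {n : Letter} {w : List Letter} (hn : n ∈ w)
    (h0 : homOperator F n = 0) : wordOperator F w = 0 :=
  List.prod_eq_zero (List.mem_map.2 ⟨n, hn, h0⟩)

/-- The words of length `l` in the mould series of depth `d`. -/
def words (d l : ℕ) : Finset (Fin l → Letter) :=
  (Fintype.piFinset fun _ : Fin l => alphabet d).filter fun w => ∑ i, letterDepth (w i) = (d : ℤ)

lemma mem_words {d l : ℕ} {w : Fin l → Letter} :
    w ∈ words d l ↔ (∀ i, w i ∈ alphabet d) ∧ ∑ i, letterDepth (w i) = (d : ℤ) := by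
  rw [words, mem_filter, Fintype.mem_piFinset]

/-- Letters with nonzero operator have depth at least r - 1, and 3(r - 1) > 2(r - 1). -/
lemma wordOperator_long (hr : 2 ≤ r) (hP : ∀ j ∈ Icc r (2 * r - 1), (P j).IsHomogeneous j)
    (hF : HasHamiltonianCoeffs (perturbedField r P) h) {l : ℕ} (hl : 3 ≤ l)
    {w : Fin l → Letter} (hw : w ∈ words (2 * (r - 1)) l) :
    wordOperator (perturbedField r P) (List.ofFn w) = 0 := by
  obtain ⟨hw1, hw2⟩ := mem_words.1 hw
  by_cases hlow : ∃ i, letterDepth (w i) < (r : ℤ) - 1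
  · obtain ⟨i, hi⟩ := hlow
    obtain ⟨a, b, h3, -, hab⟩ := mem_alphabet.1 (hw1 i)
    rw [hab, letterDepth_letter] at hi
    exact wordOperator_eq_zero ((List.mem_ofFn' _ _).2 ⟨i, hab⟩)
      (homOperator_eq_zero hP hF h3 (by omega))
  · push Not at hlow
    have h1 := card_nsmul_le_sum univ (fun i => letterDepth (w i)) _ fun i _ => hlow i
    rw [hw2, card_univ, Fintype.card_fin, nsmul_eq_mul] at h1
    have h2 : (3 : ℤ) * (r - 1) ≤ l * (r - 1) :=
      mul_le_mul_of_nonneg_right (by exact_mod_cast hl) (by omega)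
    omega

lemma sum_words_one (hr : 2 ≤ r) (F : PolyField) :
    ∑ w ∈ words (2 * (r - 1)) 1, carrMould (List.ofFn w) • wordOperator F (List.ofFn w) =
      homOperator F (letter r r) := by
  rw [sum_eq_single (fun _ => letter r r)]
  · simp [carrMould_letter, weight_letter, wordOperator]
  · intro w hw hne
    obtain ⟨hw1, hw2⟩ := mem_words.1 hw
    obtain ⟨a, b, h3, -, hab⟩ := mem_alphabet.1 (hw1 0)
    rw [Fin.sum_univ_one, hab, letterDepth_letter] at hw2
    rw [List.ofFn_succ, List.ofFn_zero, carrMould_letter, hab, if_neg, zero_smul]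
    rw [weight_letter_eq_zero]
    rintro rfl
    refine hne (funext fun i => ?_)
    obtain rfl : a = r := by omega
    rw [Subsingleton.elim i 0, hab]
  · intro hn
    refine absurd (mem_words.2 ⟨fun _ => mem_alphabet.2 ⟨r, r, by omega, by omega, rfl⟩, ?_⟩) hn
    rw [Fin.sum_univ_one, letterDepth_letter]
    omega

lemma letter_inj {k l k' l' : ℕ} : letter k l = letter k' l' ↔ k = k' ∧ l = l' := by
  simp only [letter, Prod.mk.injEq]
  omega

lemma letter_add {k l k' l' : ℕ} :
    weight (letter k l + letter k' l') = 0 ↔ k + k' = l + l' := by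
  have : weight (letter k l + letter k' l') =
      Complex.I * (((k + k' : ℕ) : ℂ) - ((l + l' : ℕ) : ℂ)) := by
    simp only [weight, letter, Prod.mk_add_mk]; push_cast; ring
  rw [this, mul_eq_zero, sub_eq_zero, Nat.cast_inj]
  simp

/-- Both letters must have depth exactly r - 1, and the mould requires a resonant sum; so the second
letter is the first one with its exponents exchanged. -/
lemma sum_words_two (hr : 2 ≤ r) (hP : ∀ j ∈ Icc r (2 * r - 1), (P j).IsHomogeneous j)
    (hF : HasHamiltonianCoeffs (perturbedField r P) h) :
    ∑ w ∈ words (2 * (r - 1)) 2, carrMould (List.ofFn w) •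
        wordOperator (perturbedField r P) (List.ofFn w) =
      ∑ x ∈ antidiagonal (r + 1), (-1 / (Complex.I * ((x.1 : ℂ) - x.2))) •
        (homOperator (perturbedField r P) (letter x.1 x.2) *
          homOperator (perturbedField r P) (letter x.2 x.1)) := by
  set g : ℕ × ℕ → Fin 2 → Letter := fun x => ![letter x.1 x.2, letter x.2 x.1] with hg
  have hinj : Set.InjOn g (antidiagonal (r + 1) : Finset (ℕ × ℕ)) := by
    intro x _ y _ hxy
    have := congrFun hxy 0
    exact Prod.ext_iff.2 (letter_inj.1 this)
  have hsub : (antidiagonal (r + 1)).image g ⊆ words (2 * (r - 1)) 2 := by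
    intro w hw
    obtain ⟨⟨k, l⟩, hx, rfl⟩ := mem_image.1 hw
    rw [HasAntidiagonal.mem_antidiagonal] at hx
    dsimp only at hx
    refine mem_words.2 ⟨fun i => ?_, ?_⟩
    · fin_cases i
      · exact mem_alphabet.2 ⟨k, l, by omega, by omega, rfl⟩
      · exact mem_alphabet.2 ⟨l, k, by omega, by omega, rfl⟩
    · rw [Fin.sum_univ_two]
      change letterDepth (letter k l) + letterDepth (letter l k) = _
      rw [letterDepth_letter, letterDepth_letter]
      omega
  rw [← sum_subset hsub, sum_image hinj]
  · refine sum_congr rfl ?_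
    rintro ⟨k, l⟩ hx
    rw [HasAntidiagonal.mem_antidiagonal] at hx
    dsimp only at hx ⊢
    have e : List.ofFn (g (k, l)) = [letter k l, letter l k] := by simp [hg]
    rw [e, carrMould_pair, if_pos (letter_add.2 (by omega)), weight_letter]
    simp only [wordOperator, List.map_cons, List.map_nil, List.prod_cons, List.prod_nil, mul_one]
    congr 1
    -- The mould is 0 when the first letter is resonant; this agrees with the convention -1/0 = 0.
    split_ifs with h0
    · rw [h0, div_zero]
    · rfl
  · intro w hw hn
    obtain ⟨hw1, hw2⟩ := mem_words.1 hw
    obtain ⟨k, l, h3, -, hkl⟩ := mem_alphabet.1 (hw1 0)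
    obtain ⟨k', l', h3', -, hkl'⟩ := mem_alphabet.1 (hw1 1)
    rw [Fin.sum_univ_two, hkl, hkl', letterDepth_letter, letterDepth_letter] at hw2
    have e : List.ofFn w = [letter k l, letter k' l'] := by
      rw [← hkl, ← hkl']; simp
    rw [e]
    by_cases h1 : k + l ≤ r
    · rw [wordOperator_eq_zero (n := letter k l) (by simp) (homOperator_eq_zero hP hF h3 h1),
        smul_zero]
    by_cases h2 : k' + l' ≤ r
    · rw [wordOperator_eq_zero (n := letter k' l') (by simp) (homOperator_eq_zero hP hF h3' h2),
        smul_zero]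
    rw [carrMould_pair, if_neg (c := weight (_ + _) = 0), neg_zero, zero_div, ite_self, zero_smul]
    rw [letter_add]
    intro h4
    refine hn (mem_image.2 ⟨(k, l), HasAntidiagonal.mem_antidiagonal.2 (by dsimp only; omega), ?_⟩)
    funext i
    fin_cases i
    · exact hkl.symm
    · change letter l k = w 1
      rw [hkl', letter_inj]
      omega

lemma carrDepth_eq (hr : 2 ≤ r) (hP : ∀ j ∈ Icc r (2 * r - 1), (P j).IsHomogeneous j)
    (hF : HasHamiltonianCoeffs (perturbedField r P) h) :
    carrDepth (perturbedField r P) (2 * (r - 1)) =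
      homOperator (perturbedField r P) (letter r r) +
      ∑ x ∈ antidiagonal (r + 1), (-1 / (Complex.I * ((x.1 : ℂ) - x.2))) •
        (homOperator (perturbedField r P) (letter x.1 x.2) *
          homOperator (perturbedField r P) (letter x.2 x.1)) := by
  change ∑ l ∈ range (2 * (r - 1) + 1), ∑ w ∈ words (2 * (r - 1)) l,
    carrMould (List.ofFn w) • wordOperator (perturbedField r P) (List.ofFn w) = _
  have hsub : range 3 ⊆ range (2 * (r - 1) + 1) := range_subset_range.2 (by omega)
  rw [← sum_subset hsub, sum_range_succ, sum_range_succ, sum_range_one, sum_words_one hr,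
    sum_words_two hr hP hF, sum_eq_zero, zero_add]
  · intro w _
    rw [List.ofFn_zero, carrMould, zero_smul]
  · intro l _ hl
    rw [mem_range, not_lt] at hl
    exact sum_eq_zero fun w hw => by rw [wordOperator_long hr hP hF hl hw, smul_zero]

lemma sum_commutators (hr : 2 ≤ r) (hP : ∀ j ∈ Icc r (2 * r - 1), (P j).IsHomogeneous j)
    (hF : HasHamiltonianCoeffs (perturbedField r P) h) :
    ∑ x ∈ antidiagonal (r + 1), (-1 / (Complex.I * ((x.1 : ℂ) - x.2))) •
        (homOperator (perturbedField r P) (letter x.1 x.2) *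
          homOperator (perturbedField r P) (letter x.2 x.1)) =
      (Complex.I * birkhoffSum r (P r) / r) • (hamDerivation (xyMonomial r r)).toLinearMap := by
  set B := fun k l => homOperator (perturbedField r P) (letter k l) with hB
  set g : ℕ × ℕ → Module.End ℂ (MvPolynomial (Fin 2) ℂ) := fun x =>
    (-1 / (Complex.I * ((x.1 : ℂ) - x.2))) • (B x.1 x.2 * B x.2 x.1) with hgdef
  change ∑ x ∈ antidiagonal (r + 1), g x = _
  have hs : ∑ x ∈ antidiagonal (r + 1), g x.swap = ∑ x ∈ antidiagonal (r + 1), g x :=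
    Nat.sum_antidiagonal_swap (n := r + 1) (f := g)
  have hr0 : (r : ℂ) ≠ 0 := by exact_mod_cast (by omega : r ≠ 0)
  -- The weights of a word and of its reversal are opposite, so the pair is a commutator; its factor
  -- l² - k² cancels the divisor and leaves k + l = r + 1.
  have h2 : ∑ x ∈ antidiagonal (r + 1), (g x + g x.swap) =
      (2 * (Complex.I * birkhoffSum r (P r) / r)) •
        (hamDerivation (xyMonomial r r)).toLinearMap := by
    rw [birkhoffSum_eq hr hP hF]
    push_cast
    rw [mul_sum, sum_div, mul_sum, sum_smul]
    refine sum_congr rfl ?_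
    rintro ⟨k, l⟩ hx
    rw [HasAntidiagonal.mem_antidiagonal] at hx
    simp only [hgdef, Prod.swap] at hx ⊢
    split_ifs with hkl
    · simp [hkl]
    have hsub : ∀ (c : ℂ) (u v : Module.End ℂ (MvPolynomial (Fin 2) ℂ)),
        c • u + (-c) • v = c • (u - v) := fun c u v => by module
    have hkl' : (k : ℂ) - l ≠ 0 := sub_ne_zero.2 fun h => hkl (by exact_mod_cast h)
    have hr1 : (r : ℂ) + 1 = k + l := by exact_mod_cast hx.symm
    rw [show -1 / (Complex.I * ((l : ℂ) - k)) = -(-1 / (Complex.I * ((k : ℂ) - l))) by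
      rw [← neg_sub (k : ℂ) l, mul_neg, div_neg], hsub, hB, homOperator_commutator hF hx, smul_smul, hF.mul_swap]
    congr 1
    push_cast
    rw [hr1]
    field_simp
    linear_combination (-4 * ((k : ℂ) - l) * (k + l) * ‖h k l‖ ^ 2) * Complex.I_sq
  rw [sum_add_distrib, hs, ← two_smul ℂ, mul_smul] at h2
  exact smul_right_injective _ (two_ne_zero (α := ℂ)) h2

/-- The derivation of x^r y^r is r(xy)^(r-1)(x∂x - y∂y), so the y-component carries -c, which is
conj c for imaginary c only. -/
lemma smul_hamDerivation_eq_resonantField (hr : 2 ≤ r) {c : ℂ} (hc : starRingEnd ℂ c = -c) :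
    (c / r) • hamDerivation (xyMonomial r r) =
      MvPolynomial.mkDerivation ℂ (resonantField (r - 1) c) := by
  have hr0 : (r : ℂ) ≠ 0 := by exact_mod_cast (by omega : r ≠ 0)
  obtain ⟨s, rfl⟩ : ∃ s, r = s + 1 := ⟨r - 1, by omega⟩
  refine MvPolynomial.derivation_ext fun i => ?_
  rw [Derivation.smul_apply, MvPolynomial.mkDerivation_X, MvPolynomial.smul_eq_C_mul]
  fin_cases i
  · change _ * hamDerivation _ (MvPolynomial.X 0) = resonantField _ c 0
    rw [hamDerivation_X_zero, pderiv_one_xyMonomial, ← mul_assoc, ← map_mul, div_mul_cancel₀ _ hr0]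
    simp [resonantField, xyMonomial]
    ring
  · change _ * hamDerivation _ (MvPolynomial.X 1) = resonantField _ c 1
    rw [hamDerivation_X_one, pderiv_zero_xyMonomial, mul_neg, ← mul_assoc, ← map_mul,
      div_mul_cancel₀ _ hr0]
    simp [resonantField, xyMonomial, hc]
    ring

lemma carrDepth_eq_resonantField (hr : 2 ≤ r)
    (hP : ∀ j ∈ Icc r (2 * r - 1), (P j).IsHomogeneous j)
    (hH : IsRealHamiltonian (perturbedField r P)) :
    carrDepth (perturbedField r P) (2 * (r - 1)) =
      (MvPolynomial.mkDerivation ℂ (resonantField (r - 1)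
        (xyCoeff (P (2 * r - 1)) r (r - 1) + Complex.I * birkhoffSum r (P r)))).toLinearMap := by
  obtain ⟨h, hF⟩ := hH.exists_coeffs
  have hr0 : (r : ℂ) ≠ 0 := by exact_mod_cast (by omega : r ≠ 0)
  rw [← smul_hamDerivation_eq_resonantField hr, carrDepth_eq hr hP hF, sum_commutators hr hP hF,
    homOperator_letter hF, coeff_top hr hP hF]
  · refine LinearMap.ext fun f => ?_
    change (2 * Complex.I * h r r) • hamDerivation (xyMonomial r r) f +
      (Complex.I * birkhoffSum r (P r) / r) • hamDerivation (xyMonomial r r) f =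
      ((2 * Complex.I * (r * h r r) + Complex.I * birkhoffSum r (P r)) / r : ℂ) •
        hamDerivation (xyMonomial r r) f
    rw [← add_smul]
    congr 1
    field_simp
  · rw [coeff_top hr hP hF, map_add, conj_coeff_top hF, map_mul, Complex.conj_I,
      Complex.conj_ofReal]
    ring

end

end Correction

end

theorem mainTheorem9 (r : ℕ) (hr : 2 ≤ r) (P : ℕ → MvPolynomial (Fin 2) ℂ)
    (hP : ∀ j ∈ Finset.Icc r (2 * r - 1), (P j).IsHomogeneous j)
    (hH : Correction.IsRealHamiltonian (Correction.perturbedField r P))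
    (p : ℂ) (hp : p = Correction.xyCoeff (P (2 * r - 1)) r (r - 1))
    (S : ℝ) (hS : S = Correction.birkhoffSum r (P r)) :
    -- the mould series in depth `2 (r - 1)`
    Correction.carrDepth (Correction.perturbedField r P) (2 * (r - 1)) =
        (MvPolynomial.mkDerivation ℂ
          (Correction.resonantField (r - 1) (p + Complex.I * S))).toLinearMap ∧
    -- the vector field `Z` that defines the correction, in depth `2 (r - 1)`
    (∀ Z : Correction.FormalField,
      Correction.IsCorrection (Correction.perturbedField r P).toFormal Z →
        ∀ i, MvPowerSeries.homogeneousComponent (2 * r - 1) (Z i) =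
          (Correction.resonantField (r - 1) (p - Complex.I * S)).toFormal i) ∧
    -- the positivity obstruction to linearisability
    (Correction.IsLinearisable (Correction.perturbedField r P).toFormal →
      p = Complex.I * S ∧ 0 ≤ p.im ∧ (p = 0 → P r = 0)) := by
  subst hp hS
  refine ⟨Correction.carrDepth_eq_resonantField hr hP hH,
    fun Z hZ i => Correction.homogeneousComponent_correction hr hP hH hZ i, fun hL => ?_⟩
  obtain ⟨h1, h2⟩ := Correction.eq_birkhoffSum_of_isLinearisable hr hP hH hL
  refine ⟨h1, ?_, fun h0 => h2 ?_⟩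
  · rw [h1]
    simpa using Correction.birkhoffSum_nonneg r (P r)
  · rw [h0, eq_comm, mul_eq_zero] at h1
    exact_mod_cast h1.resolve_left Complex.I_ne_zero
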